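/- **Theorem.** Let $T$ be a finite-dimensional theory, let $M$ be a model of $T$, and let $\mathfrak g$ be a connected Lie ring definable in $M$ (with parameters, possibly in $M^{\mathrm{eq}}$). Then there exist $n\in\mathbb N$ and a finite series $$\mathfrak g=\mathfrak h_0\ge\mathfrak h_1\ge\dots\ge\mathfrak h_n=\{0\}$$ of definable ideals of $\mathfrak g$ such that for every $i<n$ either $\mathfrak h_i/\mathfrak h_{i+1}\le Z(\mathfrak g/\mathfrak h_{i+1})$, or $\mathfrak h_i/\mathfrak h_{i+1}$ is connected, $\mathfrak g$-minimal and has the DCC. Here the following definitions are used. * A theory $T$ is *finite-dimensional* if there is a function $\dim$ from the class of all interpretable sets (with parameters) in models of $T$ into $\omega\cup\{-\infty\}$ such that: if $a,a'$ are tuples from models of $T$ with the same type over $\emptyset$, then $\dim\varphi(x,a)=\dim\varphi(x,a')$ for every formula $\varphi(x,y)$, where $x$ may range over an imaginary sort; $\dim\emptyset=-\infty$, and for nonempty $X$, $\dim X=0$ if and only if $X$ is finite; $\dim(X\cup Y)=\max\{\dim X,\dim Y\}$; and for every interpretable function $f\colon X\to Y$ between interpretable sets and every $k\in\omega$, if $\dim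 f^{-1}(y)\ge k$ for all $y\in Y$ then $\dim X\ge\dim Y+k$, and if $\dim f^{-1}(y)\le k$ for all $y\in Y$ then $\dim X\le\dim Y+k$. * "Definable" means definable with parameters from $M$. The definable subsets of $\mathfrak g/\mathfrak h$, for a definable ideal $\mathfrak h$, are those with definable preimage in $\mathfrak g$. * A definable group is *connected* if it has no proper definable subgroup of finite index (for a Lie ring and for the factors, this refers to the additive group). It has the *DCC* if it has no infinite strictly descending chain of definable subgroups. * A definable abelian group on which $\mathfrak g$ acts is *$\mathfrak g$-minimal* if it has no infinite definable $\mathfrak g$-invariant subgroup of infinite index. On $\mathfrak h_i/\mathfrak h_{i+1}$ the action is induced by the bracket. -/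

import Mathlib

open FirstOrder

universe u v w x

namespace FirstOrder.Language

/-! ### Interpretable sets -/

section Interpretable

variable (L : Language.{u, v}) (M : Type w) [L.Structure M]

/-- A sort of imaginaries of `M`: the quotient of `M ^ n` by an equivalence relation definable with
parameters. An interpretable set is a subset `X` of such a sort with `IsInterpretable X`; definable
sets are the case where the equivalence relation is equality. -/
structure ImaginarySort (n : ℕ) where
  /-- the equivalence relation on `M ^ n` -/
  rel : Setoid (Fin n → M)
  definable_rel : (Set.univ : Set M).Definable L
    {p : Fin n ⊕ Fin n → M | rel (p ∘ Sum.inl) (p ∘ Sum.inr)}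

variable {L M}

namespace ImaginarySort

/-- The elements of the sort, that is, the classes of the equivalence relation. -/
def Elem {n : ℕ} (S : L.ImaginarySort M n) : Type w := Quotient S.rel

/-- The class of a tuple. -/
def cls {n : ℕ} (S : L.ImaginarySort M n) (p : Fin n → M) : S.Elem := Quotient.mk S.rel p

/-- A set of imaginaries is interpretable if the set of representatives of its elements is
definable with parameters. -/
def IsInterpretable {n : ℕ} (S : L.ImaginarySort M n) (X : Set S.Elem) : Prop :=
  (Set.univ : Set M).Definable L {p : Fin n → M | S.cls p ∈ X}

/-- A function between subsets of sorts is interpretable if its graph is. -/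
def IsInterpretableFun {n m : ℕ} {S : L.ImaginarySort M n} {S' : L.ImaginarySort M m}
    {X : Set S.Elem} {Y : Set S'.Elem} (f : X → Y) : Prop :=
  (Set.univ : Set M).Definable L
    {p : Fin n ⊕ Fin m → M | ∃ t : X, (t : S.Elem) = S.cls (p ∘ Sum.inl) ∧
      (f t : S'.Elem) = S'.cls (p ∘ Sum.inr)}

/-- The sort `S` and its subset `X` are given by the formulas `ε(y, z, z')` and `φ(y, z)` with
`y` replaced by the tuple of parameters `a`: so `X` is the interpretable set `φ(M, a) / ε(a)`. -/
def IsGivenBy {k n : ℕ} (S : L.ImaginarySort M n) (X : Set S.Elem)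
    (ε : L.Formula (Fin k ⊕ (Fin n ⊕ Fin n))) (φ : L.Formula (Fin k ⊕ Fin n))
    (a : Fin k → M) : Prop :=
  (∀ p q : Fin n → M, ε.Realize (Sum.elim a (Sum.elim p q)) ↔ S.rel p q) ∧
    ∀ p : Fin n → M, φ.Realize (Sum.elim a p) ↔ S.cls p ∈ X

end ImaginarySort

end Interpretable

/-! ### Finite-dimensional theories -/

namespace Theory

/-- `dim` is a dimension on the interpretable sets of all models of `T`, with values in
`ω ∪ {-∞}`, where `-∞` is `⊥`. Its values on sets that are not interpretable are irrelevant. -/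
structure IsDimension {L : Language.{u, v}} (T : L.Theory)
    (dim : ∀ (M : ModelType.{u, v, w} T) (n : ℕ) (S : L.ImaginarySort M n),
      Set S.Elem → WithBot ℕ) : Prop where
  /-- The dimension of `φ(x, a)` depends only on `φ` and on the type of `a` over `∅`. -/
  invariant : ∀ (M M' : ModelType.{u, v, w} T) (k n : ℕ)
    (ε : L.Formula (Fin k ⊕ (Fin n ⊕ Fin n))) (φ : L.Formula (Fin k ⊕ Fin n))
    (a : Fin k → M) (a' : Fin k → M')
    (S : L.ImaginarySort M n) (X : Set S.Elem) (S' : L.ImaginarySort M' n) (X' : Set S'.Elem),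
    T.typeOf a = T.typeOf a' → S.IsGivenBy X ε φ a → S'.IsGivenBy X' ε φ a' →
      dim M n S X = dim M' n S' X'
  dim_empty : ∀ (M : ModelType.{u, v, w} T) (n : ℕ) (S : L.ImaginarySort M n),
    dim M n S ∅ = ⊥
  dim_eq_zero_iff : ∀ (M : ModelType.{u, v, w} T) (n : ℕ) (S : L.ImaginarySort M n)
    (X : Set S.Elem), S.IsInterpretable X → X.Nonempty → (dim M n S X = 0 ↔ X.Finite)
  dim_union : ∀ (M : ModelType.{u, v, w} T) (n : ℕ) (S : L.ImaginarySort M n)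
    (X Y : Set S.Elem), S.IsInterpretable X → S.IsInterpretable Y →
      dim M n S (X ∪ Y) = max (dim M n S X) (dim M n S Y)
  le_dim_of_le_dim_fiber : ∀ (M : ModelType.{u, v, w} T) (n m : ℕ)
    (S : L.ImaginarySort M n) (S' : L.ImaginarySort M m) (X : Set S.Elem) (Y : Set S'.Elem)
    (f : X → Y) (k : ℕ), S.IsInterpretable X → S'.IsInterpretable Y →
      ImaginarySort.IsInterpretableFun f →
      (∀ y : Y, (k : WithBot ℕ) ≤ dim M n S (Subtype.val '' (f ⁻¹' {y}))) →
      dim M m S' Y + k ≤ dim M n S X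
  dim_le_of_dim_fiber_le : ∀ (M : ModelType.{u, v, w} T) (n m : ℕ)
    (S : L.ImaginarySort M n) (S' : L.ImaginarySort M m) (X : Set S.Elem) (Y : Set S'.Elem)
    (f : X → Y) (k : ℕ), S.IsInterpretable X → S'.IsInterpretable Y →
      ImaginarySort.IsInterpretableFun f →
      (∀ y : Y, dim M n S (Subtype.val '' (f ⁻¹' {y})) ≤ (k : WithBot ℕ)) →
      dim M n S X ≤ dim M m S' Y + k

/-- A theory is finite-dimensional if there is a dimension on the interpretable sets of its
models. The universe of the models is large enough for every cardinality of the language. -/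
def FiniteDimensional {L : Language.{u, v}} (T : L.Theory) : Prop :=
  ∃ dim : ∀ (M : ModelType.{u, v, max u v w} T) (n : ℕ) (S : L.ImaginarySort M n),
    Set S.Elem → WithBot ℕ, T.IsDimension dim

end Theory

/-! ### Definable Lie rings -/

/-- A presentation of the Lie ring `𝔤` as a Lie ring definable (with parameters, possibly with
imaginary elements) in `M`: a bijection of `𝔤` with an interpretable set which makes addition and
bracket definable. -/
structure LieRingPresentation (L : Language.{u, v}) (M : Type w) [L.Structure M]
    (𝔤 : Type x) [LieRing 𝔤] where
  arity : ℕ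
  sort : L.ImaginarySort M arity
  coord : 𝔤 → sort.Elem
  coord_injective : Function.Injective coord
  definable_range : sort.IsInterpretable (Set.range coord)
  definable_add : (Set.univ : Set M).Definable L
    {p : Fin 3 × Fin arity → M | ∃ a b : 𝔤, coord a = sort.cls (fun j => p (0, j)) ∧
      coord b = sort.cls (fun j => p (1, j)) ∧ coord (a + b) = sort.cls (fun j => p (2, j))}
  definable_bracket : (Set.univ : Set M).Definable L
    {p : Fin 3 × Fin arity → M | ∃ a b : 𝔤, coord a = sort.cls (fun j => p (0, j)) ∧
      coord b = sort.cls (fun j => p (1, j)) ∧ coord ⁅a, b⁆ = sort.cls (fun j => p (2, j))}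

namespace LieRingPresentation

variable {L : Language.{u, v}} {M : Type w} [L.Structure M] {𝔤 : Type x} [LieRing 𝔤]

/-- The definable subsets of the Lie ring. -/
def IsDefinable (P : L.LieRingPresentation M 𝔤) (X : Set 𝔤) : Prop :=
  P.sort.IsInterpretable (P.coord '' X)

/-- The definable subsets of the quotient of the Lie ring by a definable ideal: those whose
preimage is definable. -/
def IsDefinableQuot (P : L.LieRingPresentation M 𝔤) (I : LieIdeal ℤ 𝔤) (X : Set (𝔤 ⧸ I)) : Prop :=
  P.IsDefinable ((LieSubmodule.Quotient.mk : 𝔤 → 𝔤 ⧸ I) ⁻¹' X)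

end LieRingPresentation

end FirstOrder.Language

/-! ### Connectedness, minimality and the descending chain condition

Here `Def` is the class of definable subsets of the ambient definable group `A`. -/

section Groups

variable {A : Type x} [AddCommGroup A]

/-- `H` is connected: it has no proper definable subgroup of finite index. -/
def IsDefinablyConnected (Def : Set A → Prop) (H : AddSubgroup A) : Prop :=
  ∀ K : AddSubgroup A, K ≤ H → Def K → K.IsFiniteRelIndex H → K = H

/-- `H` has no strictly descending infinite chain of definable subgroups. -/
def HasDefinableDCC (Def : Set A → Prop) (H : AddSubgroup A) : Prop :=
  ¬ ∃ K : ℕ → AddSubgroup A, StrictAnti K ∧ ∀ i, K i ≤ H ∧ Def (K i)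

/-- `H` is `𝔤`-minimal: it has no infinite definable `𝔤`-invariant subgroup of infinite index. -/
def IsDefinablyMinimalFor (𝔤 : Type w) [LieRing 𝔤] [LieRingModule 𝔤 A]
    (Def : Set A → Prop) (H : AddSubgroup A) : Prop :=
  ∀ K : AddSubgroup A, K ≤ H → Def K → (∀ a : 𝔤, ∀ k ∈ K, ⁅a, k⁆ ∈ K) →
    (K : Set A).Infinite → K.IsFiniteRelIndex H

end Groups

/-- The factor `I / J`, as a subgroup of `𝔤 / J`. -/
def idealFactor {𝔤 : Type x} [LieRing 𝔤] (I J : LieIdeal ℤ 𝔤) : AddSubgroup (𝔤 ⧸ J) :=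
  (LieSubmodule.map (LieSubmodule.Quotient.mk' J) I).toAddSubgroup

/-! The argument lives in the lattice of definable subgroups of `𝔤`, with a dimension for which
nested subgroups have equal dimension exactly when the index is finite. `DefinableDimension`
isolates what is used. Besides closure properties it has one substantial axiom,
`almostLE_transporter`: if `𝔤` is connected and every `ad x` maps `C` into `D` up to finite index,
then a subgroup of finite index in `C` satisfies `[𝔤, c] ⊆ D` for all its elements `c`. It is proved
by computing the dimension of `{(x, c) | c ∈ C, [x, c] ∈ D}` along both projections.

The series comes from induction on the dimension of a connected definable ideal `I`. The subgroup
`[𝔤, I]` is definable and connected, being a sum of images of the connected `𝔤`. If it is smaller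
than `I`, it gives a central factor. If `I = [𝔤, I] ≠ 0`, a proper definable ideal `J` of maximal
dimension gives a minimal factor `I / J`; then `J / [𝔤, J]` is central and `[𝔤, J]` is again
connected.

The main point is the DCC for `I / J`. A definable subgroup between `J` and `I`, infinite modulo `J`
and invariant up to finite index, is all of `I` (`eq_of_almost_invariant`). So for any definable `C
≤ I` infinite modulo `J`, `I` is the sum of `J` and finitely many images of `C` under words in the
`ad x`. For `C` of least dimension, a shortest such sum bounds the finite indices of definable
subgroups of `C` containing `J`, and `C` can be shrunk until none of them is proper of finite index
(`exists_strongly_minimal`). The DCC is then clear for `C` and passes to finite sums of its images.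
-/

/-! ### Commensurability of subgroups of abelian groups -/

namespace AddSubgroup

variable {A B : Type*} [AddCommGroup A] [AddCommGroup B]

/-- `K` is contained in `H` up to finite index. -/
def AlmostLE (K H : AddSubgroup A) : Prop := H.relIndex K ≠ 0

theorem almostLE_of_le {K H : AddSubgroup A} (h : K ≤ H) : K.AlmostLE H := by
  rw [AlmostLE, relIndex_eq_one.2 h]; exact one_ne_zero

theorem AlmostLE.mono {K K' H H' : AddSubgroup A} (h : K.AlmostLE H) (hK : K' ≤ K)
    (hH : H ≤ H') : K'.AlmostLE H' := by
  intro h0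
  exact h (relIndex_eq_zero_of_le_right hK (relIndex_eq_zero_of_le_left hH h0))

theorem AlmostLE.trans {K H G : AddSubgroup A} (h : K.AlmostLE H) (h' : H.AlmostLE G) :
    K.AlmostLE G := relIndex_ne_zero_trans h' h

theorem AlmostLE.sup_right {K H : AddSubgroup A} (h : K.AlmostLE H) : (K ⊔ H).AlmostLE H := by
  rwa [AlmostLE, relIndex_sup_right]

theorem AlmostLE.sup {K K' H : AddSubgroup A} (h : K.AlmostLE H) (h' : K'.AlmostLE H) :
    (K ⊔ K').AlmostLE H := by
  have h1 : (K' ⊔ (K ⊔ H)).AlmostLE (K ⊔ H) := (h'.mono le_rfl le_sup_right).sup_right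
  refine (h1.trans h.sup_right).mono ?_ le_rfl
  exact sup_le (le_sup_left.trans le_sup_right) le_sup_left

theorem AlmostLE.map {K H : AddSubgroup A} (h : K.AlmostLE H) (f : A →+ B) :
    (K.map f).AlmostLE (H.map f) := by
  rw [AlmostLE, relIndex_map_map]
  exact (h.mono le_rfl le_sup_left).sup (almostLE_of_le le_sup_right)

theorem almostLE_comap {K : AddSubgroup A} {H : AddSubgroup B} (f : A →+ B) :
    K.AlmostLE (H.comap f) ↔ (K.map f).AlmostLE H := by
  rw [AlmostLE, AlmostLE, relIndex_comap]

theorem AlmostLE.inf {K H H' : AddSubgroup A} (h : K.AlmostLE H) (h' : K.AlmostLE H') :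
    K.AlmostLE (H ⊓ H') := relIndex_inf_ne_zero h h'

theorem AlmostLE.inf_self {K H : AddSubgroup A} (h : K.AlmostLE H) : K.AlmostLE (H ⊓ K) :=
  h.inf (almostLE_of_le le_rfl)

end AddSubgroup

open AddSubgroup

/-! ### Adjoint maps and the abstract dimension on definable subgroups -/

/-- The endomorphism `y ↦ ⁅x, y⁆` of the additive group of a Lie ring. -/
def adHom {𝔤 : Type x} [LieRing 𝔤] (x : 𝔤) : 𝔤 →+ 𝔤 := AddMonoidHom.mk' (fun y => ⁅x, y⁆) (lie_add x)

@[simp] theorem adHom_apply {𝔤 : Type x} [LieRing 𝔤] (x y : 𝔤) : adHom x y = ⁅x, y⁆ := rfl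

/-- The elements `c` with `[𝔤, c] ⊆ D`. -/
def lieTransporter {𝔤 : Type x} [LieRing 𝔤] (D : AddSubgroup 𝔤) : AddSubgroup 𝔤 :=
  ⨅ x : 𝔤, D.comap (adHom x)

theorem mem_lieTransporter {𝔤 : Type x} [LieRing 𝔤] {D : AddSubgroup 𝔤} {c : 𝔤} :
    c ∈ lieTransporter D ↔ ∀ x : 𝔤, ⁅x, c⁆ ∈ D := by
  simp [lieTransporter, AddSubgroup.mem_iInf]

/-- A class of definable subsets of a Lie ring, with a dimension on the definable subgroups, which
are closed under the operations that occur in the structure theory. -/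
structure DefinableDimension (𝔤 : Type x) [LieRing 𝔤] where
  Def : Set 𝔤 → Prop
  dim : AddSubgroup 𝔤 → ℕ
  def_bot : Def (⊥ : AddSubgroup 𝔤)
  def_top : Def (⊤ : AddSubgroup 𝔤)
  def_inf : ∀ H K : AddSubgroup 𝔤, Def H → Def K → Def (H ⊓ K : AddSubgroup 𝔤)
  def_sup : ∀ H K : AddSubgroup 𝔤, Def H → Def K → Def (H ⊔ K : AddSubgroup 𝔤)
  def_map : ∀ (x : 𝔤) (H : AddSubgroup 𝔤), Def H → Def (H.map (adHom x))
  def_comap : ∀ (x : 𝔤) (H : AddSubgroup 𝔤), Def H → Def (H.comap (adHom x))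
  def_transporter : ∀ H : AddSubgroup 𝔤, Def H → Def (lieTransporter H)
  dim_mono : ∀ H K : AddSubgroup 𝔤, Def H → Def K → H ≤ K → dim H ≤ dim K
  dim_le_iff : ∀ H K : AddSubgroup 𝔤, Def H → Def K → H ≤ K → (dim K ≤ dim H ↔ K.AlmostLE H)
  almostLE_transporter : IsDefinablyConnected Def (⊤ : AddSubgroup 𝔤) →
    ∀ C D : AddSubgroup 𝔤, Def C → Def D → (∀ x : 𝔤, C.AlmostLE (D.comap (adHom x))) →
      C.AlmostLE (lieTransporter D)

namespace DefinableDimension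

variable {𝔤 : Type x} [LieRing 𝔤] (S : DefinableDimension 𝔤)

/-- Connected subgroups. -/
def Conn (H : AddSubgroup 𝔤) : Prop := IsDefinablyConnected S.Def H

variable {S}

/-- `K ⊓ H` has finite index in the connected `H`, hence equals it. This turns inclusions up to
finite index into true inclusions. -/
theorem Conn.le {H K : AddSubgroup 𝔤} (hH : S.Conn H) (dH : S.Def H) (dK : S.Def K)
    (h : H.AlmostLE K) : H ≤ K := by
  have := hH (K ⊓ H) inf_le_right (S.def_inf _ _ dK dH) ⟨h.inf_self⟩
  rw [← this]; exact inf_le_left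

theorem conn_of_le {H : AddSubgroup 𝔤}
    (h : ∀ K : AddSubgroup 𝔤, S.Def K → H.AlmostLE K → H ≤ K) : S.Conn H :=
  fun K hK dK hf => le_antisymm hK (h K dK hf.1)

theorem Conn.eq_of_dim_le {H K : AddSubgroup 𝔤} (hK : S.Conn K) (dH : S.Def H) (dK : S.Def K)
    (h : H ≤ K) (hd : S.dim K ≤ S.dim H) : H = K :=
  le_antisymm h (hK.le dK dH ((S.dim_le_iff H K dH dK h).1 hd))

theorem Conn.map {H : AddSubgroup 𝔤} (hH : S.Conn H) (dH : S.Def H) (x : 𝔤) :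
    S.Conn (H.map (adHom x)) := by
  refine conn_of_le fun K dK hK => ?_
  rw [AddSubgroup.map_le_iff_le_comap]
  exact hH.le dH (S.def_comap x K dK) ((almostLE_comap _).2 hK)

theorem Conn.sup {H H' : AddSubgroup 𝔤} (hH : S.Conn H) (dH : S.Def H) (hH' : S.Conn H')
    (dH' : S.Def H') : S.Conn (H ⊔ H') :=
  conn_of_le fun _ dK hK => sup_le (hH.le dH dK (hK.mono le_sup_left le_rfl))
    (hH'.le dH' dK (hK.mono le_sup_right le_rfl))

theorem conn_bot : S.Conn ⊥ := conn_of_le fun _ _ _ => bot_le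

theorem exists_minimal {α : Type*} (p : α → Prop) (f : α → ℕ) (h : ∃ a, p a) :
    ∃ a, p a ∧ ∀ b, p b → f a ≤ f b := by
  obtain ⟨a, ha, hm⟩ := exists_minimalFor_of_wellFoundedLT p f h
  refine ⟨a, ha, fun b hb => ?_⟩
  by_contra hlt
  exact hlt (hm hb (le_of_not_ge hlt))

theorem exists_maximal {α : Type*} (p : α → Prop) (f : α → ℕ) (B : ℕ) (hB : ∀ a, p a → f a ≤ B)
    (h : ∃ a, p a) : ∃ a, p a ∧ ∀ b, p b → f b ≤ f a := by
  obtain ⟨a, ha, hm⟩ := exists_minimal p (fun a => B - f a) h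
  refine ⟨a, ha, fun b hb => ?_⟩
  have := hm b hb
  have := hB a ha
  have := hB b hb
  omega

theorem dim_le_top {H : AddSubgroup 𝔤} (dH : S.Def H) : S.dim H ≤ S.dim ⊤ :=
  S.dim_mono _ _ dH S.def_top le_top

/-- A finite partial sum of maximal dimension already contains every `H i`: adding one more summand
keeps the dimension, so the old sum has finite index in a connected group. -/
theorem def_conn_iSup {ι : Type*} (H : ι → AddSubgroup 𝔤) (dH : ∀ i, S.Def (H i))
    (hH : ∀ i, S.Conn (H i)) :
    S.Def (⨆ i, H i : AddSubgroup 𝔤) ∧ S.Conn (⨆ i, H i) := by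
  classical
  have key : ∀ s : Finset ι, S.Def (s.sup H : AddSubgroup 𝔤) ∧ S.Conn (s.sup H) := by
    intro s
    induction s using Finset.induction_on with
    | empty => exact ⟨S.def_bot, conn_bot⟩
    | insert a s _ ih =>
      rw [Finset.sup_insert]
      exact ⟨S.def_sup _ _ (dH a) ih.1, (hH a).sup (dH a) ih.2 ih.1⟩
  obtain ⟨s, -, hs⟩ := exists_maximal (fun _ : Finset ι => True) (fun s => S.dim (s.sup H))
    (S.dim ⊤) (fun s _ => dim_le_top (key s).1) ⟨∅, trivial⟩
  have : ⨆ i, H i = s.sup H := by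
    refine le_antisymm (iSup_le fun i => ?_) (Finset.sup_le fun i _ => le_iSup H i)
    have h1 := (key (insert i s)).2.eq_of_dim_le (key s).1 (key (insert i s)).1
      (Finset.sup_mono (Finset.subset_insert i s)) (hs _ trivial)
    rw [h1]
    exact Finset.le_sup (Finset.mem_insert_self i s)
  rw [this]
  exact key s

/-! ### The subgroups `[𝔤, D]` and ideals -/

/-- The subgroup generated by the brackets `⁅c, x⁆` with `c ∈ D`. -/
def lieSpan (D : AddSubgroup 𝔤) : AddSubgroup 𝔤 := ⨆ c : D, (⊤ : AddSubgroup 𝔤).map (adHom (c : 𝔤))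

/-- By antisymmetry of the bracket, `lieSpan` and `lieTransporter` form a Galois connection. -/
theorem lieSpan_le {D E : AddSubgroup 𝔤} : lieSpan D ≤ E ↔ D ≤ lieTransporter E := by
  rw [lieSpan, iSup_le_iff, SetLike.le_def, Subtype.forall]
  refine forall₂_congr fun c _ => ?_
  rw [mem_lieTransporter, SetLike.le_def]
  constructor
  · intro h x
    rw [← lie_skew, neg_mem_iff]
    exact h ⟨x, trivial, rfl⟩
  · rintro h _ ⟨x, -, rfl⟩
    rw [adHom_apply, ← lie_skew, neg_mem_iff]
    exact h x

theorem lie_mem_lieSpan {D : AddSubgroup 𝔤} {c : 𝔤} (hc : c ∈ D) (x : 𝔤) : ⁅x, c⁆ ∈ lieSpan D :=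
  mem_lieTransporter.1 (lieSpan_le.1 le_rfl hc) x

theorem lieSpan_mono {D E : AddSubgroup 𝔤} (h : D ≤ E) : lieSpan D ≤ lieSpan E :=
  lieSpan_le.2 (h.trans (lieSpan_le.1 le_rfl))

theorem lieTransporter_mono {D E : AddSubgroup 𝔤} (h : D ≤ E) :
    lieTransporter D ≤ lieTransporter E := fun _ hc =>
  mem_lieTransporter.2 fun x => h (mem_lieTransporter.1 hc x)

/-- Each summand `[c, 𝔤]` is an image of the connected `𝔤`; nothing is needed from `D`, which need
not even be definable. -/
theorem def_conn_lieSpan (hg : S.Conn ⊤) (D : AddSubgroup 𝔤) :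
    S.Def (lieSpan D) ∧ S.Conn (lieSpan D) :=
  def_conn_iSup _ (fun _ => S.def_map _ _ S.def_top) (fun _ => hg.map S.def_top _)

/-- Subgroups which are ideals. -/
def IsIdeal (K : AddSubgroup 𝔤) : Prop := K ≤ lieTransporter K

theorem IsIdeal.sup {H K : AddSubgroup 𝔤} (hH : IsIdeal H) (hK : IsIdeal K) : IsIdeal (H ⊔ K) :=
  sup_le (hH.trans (lieTransporter_mono le_sup_left)) (hK.trans (lieTransporter_mono le_sup_right))

theorem IsIdeal.lieSpan {H : AddSubgroup 𝔤} (hH : IsIdeal H) : IsIdeal (lieSpan H) := by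
  have : DefinableDimension.lieSpan H ≤ H := lieSpan_le.2 hH
  exact this.trans (lieSpan_le.1 le_rfl)

/-! ### Minimal sections and almost invariant subgroups -/

/-- `I / J` is a connected, `𝔤`-minimal and perfect section of `𝔤`. -/
structure MinimalSection (S : DefinableDimension 𝔤) (I J : AddSubgroup 𝔤) : Prop where
  conn_top : S.Conn ⊤
  le : J ≤ I
  def_left : S.Def I
  def_right : S.Def J
  conn : S.Conn I
  ideal_left : IsIdeal I
  ideal_right : IsIdeal J
  ne : J ≠ I
  lieSpan_eq : lieSpan I = I
  minimal : ∀ K : AddSubgroup 𝔤, S.Def K → J ≤ K → K ≤ I → IsIdeal K → K.AlmostLE J ∨ K = I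

namespace MinimalSection

variable {I J : AddSubgroup 𝔤} (h : MinimalSection S I J)
include h

/-- The elements acting trivially form a finite subgroup. -/
theorem transporter_almostLE : (lieTransporter J ⊓ I).AlmostLE J := by
  refine (h.minimal _ (S.def_inf _ _ (S.def_transporter _ h.def_right) h.def_left)
    (le_inf h.ideal_right h.le) inf_le_right ?_).resolve_right ?_
  · intro c hc
    refine mem_lieTransporter.2 fun x => ?_
    have hx := mem_lieTransporter.1 hc.1 x
    exact ⟨h.ideal_right hx, h.le hx⟩
  -- Otherwise `I = [𝔤, I] ≤ J`.
  · intro he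
    have h1 : I ≤ lieTransporter J := by rw [← he]; exact inf_le_left
    have h2 := lieSpan_le.2 h1
    rw [h.lieSpan_eq] at h2
    exact h.ne (le_antisymm h.le h2)

/-- A definable subgroup which is infinite modulo `J` and invariant up to finite index is
everything. -/
theorem eq_of_almost_invariant {D : AddSubgroup 𝔤} (dD : S.Def D) (hJD : J ≤ D) (hDI : D ≤ I)
    (hinf : ¬ D.AlmostLE J) (hinv : ∀ x : 𝔤, (D.map (adHom x)).AlmostLE D) : D = I := by
  let p : AddSubgroup 𝔤 → Prop := fun D' => S.Def D' ∧ J ≤ D' ∧ D' ≤ D ∧ D.AlmostLE D' ∧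
    ∀ x : 𝔤, (D'.map (adHom x)).AlmostLE D'
  -- Replacing `D'` by its elements `c` with `[𝔤, c] ⊆ D'` costs only finite index, by the
  -- transporter axiom.
  have step : ∀ D', p D' → p (D' ⊓ lieTransporter D') := by
    rintro D' ⟨d1, d2, d3, d4, d5⟩
    have e : D'.AlmostLE (D' ⊓ lieTransporter D') :=
      (almostLE_of_le le_rfl).inf (S.almostLE_transporter h.conn_top D' D' d1 d1
        fun x => (almostLE_comap _).2 (d5 x))
    refine ⟨S.def_inf _ _ d1 (S.def_transporter _ d1),
      le_inf d2 (h.ideal_right.trans (lieTransporter_mono d2)), inf_le_left.trans d3,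
      d4.trans e, fun x => ?_⟩
    exact ((d5 x).mono (AddSubgroup.map_mono inf_le_left) le_rfl).trans e
  -- The connected group `[𝔤, D']` can only shrink under the step; at least dimension it is
  -- stationary. Then `E = [𝔤, D₀] = [𝔤, D₂] ≤ D₁ ≤ D₀`, so `[𝔤, E] ≤ [𝔤, D₀] = E` and `E` is an
  -- ideal.
  obtain ⟨D₀, hD₀, hmin⟩ := exists_minimal p (fun D' => S.dim (lieSpan D'))
    ⟨D, dD, hJD, le_rfl, almostLE_of_le le_rfl, hinv⟩
  set D₁ := D₀ ⊓ lieTransporter D₀ with hD₁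
  set D₂ := D₁ ⊓ lieTransporter D₁ with hD₂
  have hl : lieSpan D₂ = lieSpan D₀ :=
    (def_conn_lieSpan h.conn_top D₀).2.eq_of_dim_le (def_conn_lieSpan h.conn_top D₂).1
      (def_conn_lieSpan h.conn_top D₀).1 (lieSpan_mono (inf_le_left.trans inf_le_left))
      (hmin _ (step _ (step _ hD₀)))
  have hE1 : lieSpan D₀ ≤ D₁ := by
    rw [← hl]; exact lieSpan_le.2 inf_le_right
  have hEi : IsIdeal (lieSpan D₀) :=
    hE1.trans (inf_le_left.trans (lieSpan_le.1 le_rfl))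
  obtain ⟨d1, d2, d3, d4, d5⟩ := hD₀
  have hE0 : lieSpan D₀ ≤ D₀ := hE1.trans inf_le_left
  have dE := (def_conn_lieSpan h.conn_top D₀).1
  rcases h.minimal (lieSpan D₀ ⊔ J) (S.def_sup _ _ dE h.def_right) le_sup_right
    (sup_le (hE0.trans (d3.trans hDI)) h.le) (hEi.sup h.ideal_right) with hf | he
  -- If `E` is finite modulo `J`, it lies in `J` by connectedness, so `D₀` acts trivially on `𝔤`
  -- modulo `J` and is finite modulo `J`, as then is `D`.
  · exfalso
    have h1 : lieSpan D₀ ≤ J := (def_conn_lieSpan h.conn_top D₀).2.le dE h.def_right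
      (hf.mono le_sup_left le_rfl)
    have h2 : D₀ ≤ lieTransporter J ⊓ I := le_inf (lieSpan_le.1 h1) (d3.trans hDI)
    exact hinf (d4.trans (h.transporter_almostLE.mono h2 le_rfl))
  · refine le_antisymm hDI ?_
    rw [← he]
    exact sup_le (hE0.trans d3) hJD

end MinimalSection

/-! ### Sums of images under words in the adjoint maps -/

/-- The composition of the maps `adHom x` for `x` in the list. -/
def adWord : List 𝔤 → 𝔤 →+ 𝔤
  | [] => AddMonoidHom.id 𝔤
  | x :: w => (adHom x).comp (adWord w)

theorem map_adWord_nil (H : AddSubgroup 𝔤) : H.map (adWord []) = H := AddSubgroup.map_id H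

theorem map_adWord_cons (x : 𝔤) (w : List 𝔤) (H : AddSubgroup 𝔤) :
    H.map (adWord (x :: w)) = (H.map (adWord w)).map (adHom x) :=
  (AddSubgroup.map_map H _ _).symm

theorem def_map_adWord (w : List 𝔤) {H : AddSubgroup 𝔤} (dH : S.Def H) :
    S.Def (H.map (adWord w)) := by
  induction w with
  | nil => rwa [map_adWord_nil]
  | cons x w ih => rw [map_adWord_cons]; exact S.def_map _ _ ih

theorem def_comap_adWord (w : List 𝔤) {H : AddSubgroup 𝔤} (dH : S.Def H) :
    S.Def (H.comap (adWord w)) := by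
  induction w generalizing H with
  | nil => exact dH
  | cons x w ih => exact ih (S.def_comap x _ dH)

theorem IsIdeal.map_adHom_le {K : AddSubgroup 𝔤} (hK : IsIdeal K) (x : 𝔤) :
    K.map (adHom x) ≤ K := by
  rw [AddSubgroup.map_le_iff_le_comap]
  exact fun c hc => mem_lieTransporter.1 (hK hc) x

theorem IsIdeal.map_adWord_le {K : AddSubgroup 𝔤} (hK : IsIdeal K) (w : List 𝔤) :
    K.map (adWord w) ≤ K := by
  induction w with
  | nil => rw [map_adWord_nil]
  | cons x w ih => rw [map_adWord_cons]; exact (AddSubgroup.map_mono ih).trans (hK.map_adHom_le x)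

/-- The subgroup generated by `J` and by the images of `C` under the words in `l`. -/
def wordSpan (J C : AddSubgroup 𝔤) (l : List (List 𝔤)) : AddSubgroup 𝔤 :=
  l.foldr (fun r D => C.map (adWord r) ⊔ D) J

@[simp] theorem wordSpan_cons (J C : AddSubgroup 𝔤) (r : List 𝔤) (l : List (List 𝔤)) :
    wordSpan J C (r :: l) = C.map (adWord r) ⊔ wordSpan J C l := rfl

theorem le_wordSpan (J C : AddSubgroup 𝔤) (l : List (List 𝔤)) : J ≤ wordSpan J C l := by
  induction l with
  | nil => exact le_rfl
  | cons r l ih => exact ih.trans le_sup_right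

theorem def_wordSpan {J C : AddSubgroup 𝔤} (dJ : S.Def J) (dC : S.Def C) (l : List (List 𝔤)) :
    S.Def (wordSpan J C l) := by
  induction l with
  | nil => exact dJ
  | cons r l ih => exact S.def_sup _ _ (def_map_adWord r dC) ih

theorem wordSpan_le {J C I : AddSubgroup 𝔤} (hI : IsIdeal I) (hJ : J ≤ I) (hC : C ≤ I)
    (l : List (List 𝔤)) : wordSpan J C l ≤ I := by
  induction l with
  | nil => exact hJ
  | cons r l ih => exact sup_le ((AddSubgroup.map_mono hC).trans (hI.map_adWord_le r)) ih

theorem wordSpan_almostLE {J C C' : AddSubgroup 𝔤} (hC : C.AlmostLE C') (l : List (List 𝔤)) :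
    (wordSpan J C l).AlmostLE (wordSpan J C' l) := by
  induction l with
  | nil => exact almostLE_of_le le_rfl
  | cons r l ih =>
    exact ((hC.map _).mono le_rfl le_sup_left).sup (ih.mono le_rfl le_sup_right)

namespace MinimalSection

variable {I J : AddSubgroup 𝔤} (h : MinimalSection S I J)
include h

/-- A sum of maximal dimension contains every word image of `C` up to finite index, so it is almost
invariant and `eq_of_almost_invariant` applies. -/
theorem exists_wordSpan_eq {C : AddSubgroup 𝔤} (dC : S.Def C) (hCI : C ≤ I)
    (hinf : ¬ C.AlmostLE J) : ∃ l, wordSpan J C l = I := by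
  have dW := fun l => def_wordSpan h.def_right dC l
  obtain ⟨l, -, hl⟩ := exists_maximal (fun _ : List (List 𝔤) => True)
    (fun l => S.dim (wordSpan J C l)) (S.dim ⊤) (fun l _ => dim_le_top (dW l)) ⟨[], trivial⟩
  have key : ∀ r : List 𝔤, (C.map (adWord r)).AlmostLE (wordSpan J C l) := fun r =>
    ((S.dim_le_iff _ _ (dW l) (dW (r :: l)) le_sup_right).1 (hl _ trivial)).mono le_sup_left le_rfl
  refine ⟨l, h.eq_of_almost_invariant (dW l) (le_wordSpan J C l)
    (wordSpan_le h.ideal_left h.le hCI l) (fun hf => ?_) fun x => ?_⟩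
  · refine hinf (AlmostLE.trans ?_ hf)
    have := key []
    rwa [map_adWord_nil] at this
  · have : ∀ l', ((wordSpan J C l').map (adHom x)).AlmostLE (wordSpan J C l) := by
      intro l'
      induction l' with
      | nil =>
        exact almostLE_of_le ((h.ideal_right.map_adHom_le x).trans (le_wordSpan J C l))
      | cons r l' ih =>
        rw [wordSpan_cons, AddSubgroup.map_sup]
        refine AlmostLE.sup ?_ ih
        have := key (x :: r)
        rwa [map_adWord_cons] at this
    exact this l

/-- There is a definable subgroup, infinite modulo `J`, whose proper definable subgroups are finite
modulo `J`. -/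
theorem exists_strongly_minimal : ∃ C : AddSubgroup 𝔤, S.Def C ∧ J ≤ C ∧ C ≤ I ∧ ¬ C.AlmostLE J ∧
    ∀ K : AddSubgroup 𝔤, S.Def K → J ≤ K → K ≤ C → K.AlmostLE J ∨ K = C := by
  have hI : ¬ I.AlmostLE J := fun hf =>
    h.ne (le_antisymm h.le (h.conn.le h.def_left h.def_right hf))
  obtain ⟨C, ⟨dC, hJC, hCI, hinf⟩, hmin⟩ := exists_minimal
    (fun C : AddSubgroup 𝔤 => S.Def C ∧ J ≤ C ∧ C ≤ I ∧ ¬ C.AlmostLE J) S.dim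
    ⟨I, h.def_left, h.le, le_rfl, hI⟩
  have hC : ∀ K : AddSubgroup 𝔤, S.Def K → J ≤ K → K ≤ C → K.AlmostLE J ∨ C.AlmostLE K := by
    intro K dK hJK hKC
    by_cases hK : K.AlmostLE J
    · exact Or.inl hK
    · exact Or.inr ((S.dim_le_iff K C dK dC hKC).1 (hmin K ⟨dK, hJK, hKC.trans hCI, hK⟩))
  -- In a shortest sum the first summand is not redundant. Hence the part `F` of `C` that it sends
  -- into the sum `D` of the others is finite modulo `J`: if `F` had finite index in `C`, then `D`
  -- would have finite index in the connected `I`, so `D = I`.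
  obtain ⟨l, hl, hlmin⟩ := exists_minimal (fun l => wordSpan J C l = I) List.length
    (h.exists_wordSpan_eq dC hCI hinf)
  obtain _ | ⟨r, l⟩ := l
  · exact absurd hl h.ne
  have dD := def_wordSpan (S := S) h.def_right dC l
  set D := wordSpan J C l with hD
  set F := D.comap (adWord r) ⊓ C with hF
  have hJF : J ≤ F := le_inf (by
    rw [← AddSubgroup.map_le_iff_le_comap]
    exact (h.ideal_right.map_adWord_le r).trans (le_wordSpan J C l)) hJC
  have hFfin : F.AlmostLE J := by
    refine (hC F (S.def_inf _ _ (def_comap_adWord r dD) dC) hJF inf_le_right).resolve_right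
      fun hCF => ?_
    have h1 : (C.map (adWord r)).AlmostLE D :=
      (almostLE_comap _).1 (hCF.mono le_rfl inf_le_left)
    have h2 : I.AlmostLE D := by
      rw [← hl, wordSpan_cons]; exact h1.sup (almostLE_of_le le_rfl)
    have h3 : D = I := le_antisymm (wordSpan_le h.ideal_left h.le hCI l)
      (h.conn.le h.def_left dD h2)
    have := hlmin l h3
    simp at this
  -- If `C'` has finite index in `C`, its word images and `J` still sum to the connected `I`.
  -- Writing the image of `c ∈ C` as the image of some `c' ∈ C'` plus an element of `D` gives `c -
  -- c' ∈ F`, so `C = C' + F` and the index is at most `|F / J|`.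
  have hbound : ∀ C' : AddSubgroup 𝔤, (S.Def C' ∧ J ≤ C' ∧ C' ≤ C ∧ C.AlmostLE C') →
      C'.relIndex C ≤ J.relIndex F := by
    rintro C' ⟨dC', hJC', hC'C, hfin⟩
    have h1 : wordSpan J C' (r :: l) = I :=
      le_antisymm (wordSpan_le h.ideal_left h.le (hC'C.trans hCI) _)
        (h.conn.le h.def_left (def_wordSpan h.def_right dC' _)
          (by have := wordSpan_almostLE (J := J) hfin (r :: l); rwa [hl] at this))
    have hl' : wordSpan J C' l ≤ D := by
      rw [hD]
      clear_value D
      clear h1 hl hlmin hJF hFfin hF F dD hD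
      induction l with
      | nil => exact le_rfl
      | cons s l ih => exact sup_le_sup (AddSubgroup.map_mono hC'C) ih
    have h2 : C ≤ C' ⊔ F := by
      intro c hc
      have hrc : (adWord r) c ∈ wordSpan J C' (r :: l) := by
        rw [h1, ← hl]
        exact AddSubgroup.mem_sup_left ⟨c, hc, rfl⟩
      obtain ⟨y, ⟨c', hc', rfl⟩, d, hd, hyd⟩ := AddSubgroup.mem_sup.1 hrc
      refine AddSubgroup.mem_sup.2 ⟨c', hc', c - c', ⟨?_, C.sub_mem hc (hC'C hc')⟩, add_sub_cancel _ _⟩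
      change (adWord r) (c - c') ∈ D
      rw [map_sub, ← hyd]
      convert hl' hd using 1
      exact add_sub_cancel_left _ _
    have h3 : C = F ⊔ C' := sup_comm C' F ▸ le_antisymm h2 (sup_le hC'C inf_le_right)
    calc C'.relIndex C = C'.relIndex (F ⊔ C') := by rw [← h3]
      _ = C'.relIndex F := AddSubgroup.relIndex_sup_right _ _
      _ ≤ J.relIndex F := AddSubgroup.relIndex_le_of_le_left hJC' hFfin
  -- With the index bounded, a `C₀` of largest index admits no further proper subgroup of finite
  -- index, by multiplicativity of the index.
  obtain ⟨C₀, ⟨dC₀, hJC₀, hC₀C, hfin⟩, hmax⟩ := exists_maximal _ (fun C' => C'.relIndex C) _ hbound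
    ⟨C, dC, hJC, le_rfl, almostLE_of_le le_rfl⟩
  refine ⟨C₀, dC₀, hJC₀, hC₀C.trans hCI, fun hf => hinf (hfin.trans hf), fun K dK hJK hKC => ?_⟩
  refine (hC K dK hJK (hKC.trans hC₀C)).imp_right fun hCK => le_antisymm hKC ?_
  have h1 := hmax K ⟨dK, hJK, hKC.trans hC₀C, hCK⟩
  rw [← AddSubgroup.relIndex_mul_relIndex K C₀ C hKC hC₀C] at h1
  have h2 : K.relIndex C₀ ≤ 1 := by
    by_contra hlt
    have h3 : 0 < C₀.relIndex C := Nat.pos_of_ne_zero hfin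
    nlinarith
  have h3 : K.relIndex C₀ ≠ 0 := (hCK.mono hC₀C le_rfl)
  exact AddSubgroup.relIndex_eq_one.1 (by omega)

end MinimalSection

/-! ### The descending chain condition -/

/-- The descending chain condition for definable subgroups between `J` and `D`. -/
def DCCBetween (S : DefinableDimension 𝔤) (J D : AddSubgroup 𝔤) : Prop :=
  ∀ K : ℕ → AddSubgroup 𝔤, Antitone K → (∀ i, S.Def (K i) ∧ J ≤ K i ∧ K i ≤ D) →
    ∃ N, ∀ n ≥ N, K n = K N

/-- Once a chain leaves `C`, its members have finite, decreasing index over `J`. -/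
theorem dccBetween_of_strongly_minimal {J C : AddSubgroup 𝔤}
    (hC : ∀ K : AddSubgroup 𝔤, S.Def K → J ≤ K → K ≤ C → K.AlmostLE J ∨ K = C) :
    DCCBetween S J C := by
  intro K hK hd
  by_cases hall : ∀ n, K n = C
  · exact ⟨0, fun n _ => by rw [hall, hall]⟩
  push Not at hall
  obtain ⟨n₀, hn₀⟩ := hall
  have hfin := ((hC _ (hd n₀).1 (hd n₀).2.1 (hd n₀).2.2).resolve_right hn₀)
  obtain ⟨N, hN, hmin⟩ := exists_minimal (fun n => n₀ ≤ n) (fun n => J.relIndex (K n)) ⟨n₀, le_rfl⟩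
  refine ⟨N, fun n hn => le_antisymm (hK hn) ?_⟩
  have h1 := AddSubgroup.relIndex_mul_relIndex J (K n) (K N) (hd n).2.1 (hK hn)
  have h2 := hmin n (hN.trans hn)
  have h3 : J.relIndex (K N) ≠ 0 := hfin.mono (hK hN) le_rfl
  rw [← h1] at h2 h3
  have h4 : 0 < J.relIndex (K n) := Nat.pos_of_ne_zero (left_ne_zero_of_mul h3)
  have h5 : 0 < (K n).relIndex (K N) := Nat.pos_of_ne_zero (right_ne_zero_of_mul h3)
  exact AddSubgroup.relIndex_eq_one.1 (by nlinarith)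

/-- The condition passes to extensions. With `D` the sum over the tail of the list, `K n ⊓ D`
stabilises by induction and `K n ⊔ D` because it is recovered from its preimage in `C`; modularity
of the lattice then gives `K n`. -/
theorem DCCBetween.wordSpan {J C : AddSubgroup 𝔤} (dJ : S.Def J) (hJ : IsIdeal J) (dC : S.Def C)
    (hJC : J ≤ C) (hC : DCCBetween S J C) (l : List (List 𝔤)) :
    DCCBetween S J (wordSpan J C l) := by
  induction l with
  | nil =>
    intro K hK hd
    exact ⟨0, fun n _ => by rw [le_antisymm (hd n).2.2 (hd n).2.1,
      le_antisymm (hd 0).2.2 (hd 0).2.1]⟩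
  | cons r l ih =>
    intro K hK hd
    have dD := def_wordSpan (S := S) dJ dC l
    set D := DefinableDimension.wordSpan J C l with hD
    obtain ⟨N₁, hN₁⟩ := ih (fun n => K n ⊓ D) (fun m n hmn => inf_le_inf_right _ (hK hmn))
      (fun n => ⟨S.def_inf _ _ (hd n).1 dD, le_inf (hd n).2.1 (le_wordSpan J C l), inf_le_right⟩)
    obtain ⟨N₂, hN₂⟩ := hC (fun n => (K n ⊔ D).comap (adWord r) ⊓ C)
      (fun m n hmn => inf_le_inf_right _ (AddSubgroup.comap_mono (sup_le_sup_right (hK hmn) _)))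
      (fun n => ⟨S.def_inf _ _ (def_comap_adWord r (S.def_sup _ _ (hd n).1 dD)) dC,
        le_inf (by
          rw [← AddSubgroup.map_le_iff_le_comap]
          exact (hJ.map_adWord_le r).trans ((hd n).2.1.trans le_sup_left)) hJC, inf_le_right⟩)
    have hsup : ∀ n, K n ⊔ D =
        ((K n ⊔ D).comap (adWord r) ⊓ C).map (adWord r) ⊔ D := by
      intro n
      refine le_antisymm (fun y hy => ?_) (sup_le ?_ le_sup_right)
      · have hy' : y ∈ C.map (adWord r) ⊔ D :=
          (sup_le (hd n).2.2 le_sup_right : K n ⊔ D ≤ _) hy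
        obtain ⟨z, ⟨c, hc, rfl⟩, d, hd', rfl⟩ := AddSubgroup.mem_sup.1 hy'
        refine AddSubgroup.mem_sup.2 ⟨_, ⟨c, ⟨?_, hc⟩, rfl⟩, d, hd', rfl⟩
        have := sub_mem hy (AddSubgroup.mem_sup_right hd' : d ∈ K n ⊔ D)
        rwa [add_sub_cancel_right] at this
      · rw [AddSubgroup.map_le_iff_le_comap]; exact inf_le_left
    refine ⟨max N₁ N₂, fun n hn => ?_⟩
    have e1 : K n ⊓ D = K (max N₁ N₂) ⊓ D :=
      (hN₁ n (le_of_max_le_left hn)).trans (hN₁ _ (le_max_left _ _)).symm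
    have e2 : K n ⊔ D = K (max N₁ N₂) ⊔ D := by
      rw [hsup n, hsup (max N₁ N₂)]
      congr 2
      exact (hN₂ n (le_of_max_le_right hn)).trans (hN₂ _ (le_max_right _ _)).symm
    exact eq_of_le_of_inf_le_of_sup_le (hK hn) e1.ge e2.ge

theorem MinimalSection.dcc {I J : AddSubgroup 𝔤} (h : MinimalSection S I J) :
    DCCBetween S J I := by
  obtain ⟨C, dC, hJC, hCI, hinf, hC⟩ := h.exists_strongly_minimal
  obtain ⟨l, hl⟩ := h.exists_wordSpan_eq dC hCI hinf
  rw [← hl]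
  exact (dccBetween_of_strongly_minimal hC).wordSpan h.def_right h.ideal_right dC hJC l

/-! ### Construction of the series -/

/-- `J < I` is a step of a series: the factor is central, or it is a minimal section. -/
def IsStep (S : DefinableDimension 𝔤) (I J : AddSubgroup 𝔤) : Prop :=
  J ≤ I ∧ (lieSpan I ≤ J ∨ MinimalSection S I J)

/-- There is a finite series of definable ideals from `I` to `0`. -/
def HasSeries (S : DefinableDimension 𝔤) (I : AddSubgroup 𝔤) : Prop :=
  ∃ (n : ℕ) (h : Fin (n + 1) → AddSubgroup 𝔤), h 0 = I ∧ h (Fin.last n) = ⊥ ∧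
    (∀ i, S.Def (h i) ∧ IsIdeal (h i)) ∧ ∀ i : Fin n, S.IsStep (h i.castSucc) (h i.succ)

theorem HasSeries.cons {I J : AddSubgroup 𝔤} (hJ : S.HasSeries J) (dI : S.Def I)
    (hI : IsIdeal I) (hIJ : S.IsStep I J) : S.HasSeries I := by
  obtain ⟨n, h, h0, hl, hd, hs⟩ := hJ
  refine ⟨n + 1, Fin.cons I h, rfl, ?_, ?_, ?_⟩
  · rw [← Fin.succ_last, Fin.cons_succ, hl]
  · exact Fin.cases ⟨dI, hI⟩ hd
  · refine Fin.cases ?_ fun i => ?_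
    · simpa [h0] using hIJ
    · rw [Fin.castSucc_succ, Fin.cons_succ, Fin.cons_succ]
      exact hs i

theorem hasSeries_of_conn (hg : S.Conn ⊤) (I : AddSubgroup 𝔤) (dI : S.Def I) (cI : S.Conn I)
    (hI : IsIdeal I) : S.HasSeries I := by
  induction hd : S.dim I using Nat.strong_induction_on generalizing I with
  | _ d ih =>
  subst hd
  have hle : lieSpan I ≤ I := lieSpan_le.2 hI
  have hspan := def_conn_lieSpan hg (S := S)
  by_cases he : lieSpan I = I
  · by_cases hbot : I = ⊥
    · exact ⟨0, fun _ => I, rfl, hbot, fun _ => ⟨dI, hI⟩, fun i => i.elim0⟩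
    -- Maximal dimension makes every proper definable ideal of `𝔤` between `J` and `I` finite over
    -- `J`.
    obtain ⟨J, ⟨dJ, hJ, hJI, hne⟩, hmax⟩ := exists_maximal
      (fun J : AddSubgroup 𝔤 => S.Def J ∧ IsIdeal J ∧ J ≤ I ∧ J ≠ I) S.dim _
      (fun J hJ => dim_le_top hJ.1) ⟨⊥, S.def_bot, bot_le, bot_le, Ne.symm hbot⟩
    have hsec : MinimalSection S I J :=
      { conn_top := hg, le := hJI, def_left := dI, def_right := dJ, conn := cI, ideal_left := hI
        ideal_right := hJ, ne := hne, lieSpan_eq := he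
        minimal := fun K dK hJK hKI hK => by
          by_cases hKe : K = I
          · exact Or.inr hKe
          · exact Or.inl ((S.dim_le_iff J K dJ dK hJK).1 (hmax K ⟨dK, hK, hKI, hKe⟩)) }
    have hlt : S.dim J < S.dim I := lt_of_not_ge fun hge => hne (cI.eq_of_dim_le dJ dI hJI hge)
    have hJle : lieSpan J ≤ J := lieSpan_le.2 hJ
    -- `J` need not be connected, so the induction resumes at `[𝔤, J]`, at the price of one central
    -- factor.
    have h1 := ih _ ((S.dim_mono _ _ (hspan J).1 dJ hJle).trans_lt hlt) _ (hspan J).1 (hspan J).2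
      hJ.lieSpan rfl
    exact (h1.cons dJ hJ ⟨hJle, Or.inl le_rfl⟩).cons dI hI ⟨hJI, Or.inr hsec⟩
  · have hlt : S.dim (lieSpan I) < S.dim I :=
      lt_of_not_ge fun hge => he (cI.eq_of_dim_le (hspan I).1 dI hle hge)
    exact (ih _ hlt _ (hspan I).1 (hspan I).2 hI.lieSpan rfl).cons dI hI ⟨hle, Or.inl le_rfl⟩

/-! ### Passage to Lie ideals and quotient rings -/

/-- An additive subgroup which is an ideal, as a Lie ideal. -/
def IsIdeal.toLieIdeal {K : AddSubgroup 𝔤} (hK : IsIdeal K) : LieIdeal ℤ 𝔤 :=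
  { AddSubgroup.toIntSubmodule K with lie_mem := fun {x _} hm => mem_lieTransporter.1 (hK hm) x }

@[simp] theorem IsIdeal.mem_toLieIdeal {K : AddSubgroup 𝔤} (hK : IsIdeal K) {y : 𝔤} :
    y ∈ hK.toLieIdeal ↔ y ∈ K := Iff.rfl

/-- The quotient map by a Lie ideal, as a homomorphism of additive groups. -/
def quotHom (J : LieIdeal ℤ 𝔤) : 𝔤 →+ 𝔤 ⧸ J :=
  (LieSubmodule.Quotient.mk' J : 𝔤 →ₗ[ℤ] 𝔤 ⧸ J).toAddMonoidHom

theorem quotHom_surjective (J : LieIdeal ℤ 𝔤) : Function.Surjective (quotHom J) :=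
  LieSubmodule.Quotient.surjective_mk' J

theorem ker_quotHom {J : AddSubgroup 𝔤} (hJ : IsIdeal J) : (quotHom hJ.toLieIdeal).ker = J := by
  ext y
  exact (LieSubmodule.Quotient.mk_eq_zero (N := hJ.toLieIdeal) (m := y)).trans hJ.mem_toLieIdeal

theorem idealFactor_eq {I J : AddSubgroup 𝔤} (hI : IsIdeal I) (hJ : IsIdeal J) :
    idealFactor hI.toLieIdeal hJ.toLieIdeal = I.map (quotHom hJ.toLieIdeal) := by
  ext y
  exact LieSubmodule.mem_map (f := LieSubmodule.Quotient.mk' hJ.toLieIdeal) y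

/-- The definable subsets of a quotient are those with definable preimage. -/
def DefQuot (S : DefinableDimension 𝔤) (J : LieIdeal ℤ 𝔤) (X : Set (𝔤 ⧸ J)) : Prop :=
  S.Def ((LieSubmodule.Quotient.mk : 𝔤 → 𝔤 ⧸ J) ⁻¹' X)

theorem center_of_lieSpan_le {I J : AddSubgroup 𝔤} (hI : IsIdeal I) (hJ : IsIdeal J)
    (h : lieSpan I ≤ J) (y : 𝔤 ⧸ hJ.toLieIdeal)
    (hy : y ∈ idealFactor hI.toLieIdeal hJ.toLieIdeal) :
    y ∈ LieAlgebra.center ℤ (𝔤 ⧸ hJ.toLieIdeal) := by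
  rw [idealFactor_eq] at hy
  obtain ⟨a, ha, rfl⟩ := hy
  rw [LieModule.mem_maxTrivSubmodule]
  intro z
  obtain ⟨b, rfl⟩ := quotHom_surjective _ z
  refine (LieSubmodule.Quotient.mk_bracket _ b a).symm.trans ?_
  exact (LieSubmodule.Quotient.mk_eq_zero _).2 (hJ.mem_toLieIdeal.2 (h (lie_mem_lieSpan ha b)))

namespace MinimalSection

variable {I J : AddSubgroup 𝔤} (h : MinimalSection S I J)
include h

theorem comap_le {K : AddSubgroup (𝔤 ⧸ h.ideal_right.toLieIdeal)}
    (hK : K ≤ idealFactor h.ideal_left.toLieIdeal h.ideal_right.toLieIdeal) :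
    J ≤ K.comap (quotHom _) ∧ K.comap (quotHom _) ≤ I := by
  constructor
  · conv_lhs => rw [← ker_quotHom h.ideal_right]
    exact AddSubgroup.ker_le_comap _ _
  · rw [idealFactor_eq] at hK
    refine (AddSubgroup.comap_mono hK).trans ?_
    rw [AddSubgroup.comap_map_eq, ker_quotHom]
    exact sup_le le_rfl h.le

theorem connected_factor :
    IsDefinablyConnected (S.DefQuot h.ideal_right.toLieIdeal)
      (idealFactor h.ideal_left.toLieIdeal h.ideal_right.toLieIdeal) := by
  intro K hK dK hf
  refine le_antisymm hK ?_
  have hf' := hf.1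
  rw [idealFactor_eq] at hf' ⊢
  rw [AddSubgroup.map_le_iff_le_comap]
  exact h.conn.le h.def_left dK ((almostLE_comap _).2 hf')

/-- Minimality of the section applies to the preimage of `K`: it is finite over `J`, which makes `K`
finite, or it is `I`. -/
theorem minimal_factor :
    IsDefinablyMinimalFor 𝔤 (S.DefQuot h.ideal_right.toLieIdeal)
      (idealFactor h.ideal_left.toLieIdeal h.ideal_right.toLieIdeal) := by
  intro K hK dK hinv hinf
  obtain ⟨h1, h2⟩ := h.comap_le hK
  have hmap := AddSubgroup.map_comap_eq_self_of_surjective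
    (quotHom_surjective h.ideal_right.toLieIdeal) K
  rcases h.minimal (K.comap (quotHom _)) dK h1 h2
    (fun c hc => mem_lieTransporter.2 fun x => hinv x _ hc) with hf | he
  · exfalso
    have h3 : (⊥ : AddSubgroup _).relIndex K ≠ 0 := by
      rw [← hmap, ← AddSubgroup.relIndex_comap]
      change AddSubgroup.relIndex (quotHom h.ideal_right.toLieIdeal).ker _ ≠ 0
      rwa [ker_quotHom]
    rw [AddSubgroup.relIndex_bot_left] at h3
    exact hinf (Set.finite_coe_iff.1 (Nat.finite_of_card_ne_zero h3))
  · rw [idealFactor_eq]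
    have hKI := (congrArg (AddSubgroup.map (quotHom h.ideal_right.toLieIdeal)) he).symm.trans hmap
    rw [hKI]
    exact ⟨almostLE_of_le le_rfl⟩

theorem dcc_factor :
    HasDefinableDCC (S.DefQuot h.ideal_right.toLieIdeal)
      (idealFactor h.ideal_left.toLieIdeal h.ideal_right.toLieIdeal) := by
  rintro ⟨K, hK, hd⟩
  obtain ⟨N, hN⟩ := h.dcc (fun n => (K n).comap (quotHom _))
    (fun m n hmn => AddSubgroup.comap_mono (hK.antitone hmn))
    (fun n => ⟨(hd n).2, h.comap_le (hd n).1⟩)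
  exact (hK N.lt_succ_self).ne
    (AddSubgroup.comap_injective (quotHom_surjective _) (hN (N + 1) N.le_succ))

end MinimalSection

theorem exists_series (hg : S.Conn ⊤) :
    ∃ (n : ℕ) (h : Fin (n + 1) → LieIdeal ℤ 𝔤),
      h 0 = ⊤ ∧ h (Fin.last n) = ⊥ ∧ (∀ i, S.Def (h i : Set 𝔤)) ∧
      ∀ i : Fin n, h i.succ ≤ h i.castSucc ∧
        ((∀ y ∈ idealFactor (h i.castSucc) (h i.succ),
            y ∈ LieAlgebra.center ℤ (𝔤 ⧸ h i.succ)) ∨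
          (IsDefinablyConnected (S.DefQuot (h i.succ))
              (idealFactor (h i.castSucc) (h i.succ)) ∧
            IsDefinablyMinimalFor 𝔤 (S.DefQuot (h i.succ))
              (idealFactor (h i.castSucc) (h i.succ)) ∧
            HasDefinableDCC (S.DefQuot (h i.succ))
              (idealFactor (h i.castSucc) (h i.succ)))) := by
  obtain ⟨n, h, h0, hl, hd, hs⟩ :=
    hasSeries_of_conn hg ⊤ S.def_top hg (fun _ _ => mem_lieTransporter.2 fun _ => trivial)
  refine ⟨n, fun i => (hd i).2.toLieIdeal, ?_, ?_, fun i => (hd i).1, fun i => ⟨(hs i).1, ?_⟩⟩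
  · ext y
    simp [h0]
  · ext y
    simp [hl]
  · exact (hs i).2.imp (center_of_lieSpan_le (hd _).2 (hd _).2)
      (fun hm => ⟨hm.connected_factor, hm.minimal_factor, hm.dcc_factor⟩)

end DefinableDimension

theorem Set.Definable.congr {L : FirstOrder.Language.{u, v}} {M : Type w} [L.Structure M]
    {A : Set M} {α : Type*} {s t : Set (α → M)} (h : A.Definable L s) (e : ∀ p, p ∈ s ↔ p ∈ t) :
    A.Definable L t :=
  Set.ext e ▸ h

namespace FirstOrder.Language.LieRingPresentation

variable {L : Language.{u, v}} {M : Type w} [L.Structure M] {𝔤 : Type x} [LieRing 𝔤]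
  (P : L.LieRingPresentation M 𝔤)

/-! ### Definable relations on the Lie ring -/

section Definability

variable {ι κ : Type}

/-- The tuple `p` represents the tuple `a` of elements of the Lie ring. -/
def Represents (p : ι × Fin P.arity → M) (a : ι → 𝔤) : Prop :=
  ∀ i, P.coord (a i) = P.sort.cls fun j => p (i, j)

variable {P}

theorem Represents.unique {p : ι × Fin P.arity → M} {a b : ι → 𝔤} (ha : P.Represents p a)
    (hb : P.Represents p b) : a = b :=
  funext fun i => P.coord_injective ((ha i).trans (hb i).symm)

theorem exists_cls_eq (c : 𝔤) : ∃ q : Fin P.arity → M, P.coord c = P.sort.cls q := by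
  obtain ⟨q, hq⟩ := Quotient.exists_rep (P.coord c)
  exact ⟨q, hq.symm⟩

theorem exists_represents (a : ι → 𝔤) : ∃ p, P.Represents p a := by
  choose q hq using fun i => exists_cls_eq (P := P) (a i)
  exact ⟨fun ij => q ij.1 ij.2, hq⟩

variable (P)

/-- Definable predicates on tuples of elements of the Lie ring. -/
def DefPred (φ : (ι → 𝔤) → Prop) : Prop :=
  (Set.univ : Set M).Definable L {p : ι × Fin P.arity → M | ∃ a, P.Represents p a ∧ φ a}

variable {P}

theorem DefPred.congr {φ ψ : (ι → 𝔤) → Prop} (h : P.DefPred φ) (e : ∀ a, φ a ↔ ψ a) :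
    P.DefPred ψ := by
  obtain rfl : φ = ψ := funext fun a => propext (e a)
  exact h

theorem defPred_true [Finite ι] : P.DefPred fun _ : ι → 𝔤 => True := by
  have h := Set.definable_iInter_of_finite (fun i : ι =>
    P.definable_range.preimage_comp (fun j => ((i, j) : ι × Fin P.arity)))
  refine Set.Definable.congr
      h fun p => ?_
  simp only [Set.mem_iInter, Set.mem_preimage, Set.mem_ofPred_eq, Set.mem_range, and_true]
  exact ⟨fun hp => ⟨fun i => (hp i).choose, fun i => (hp i).choose_spec⟩,
    fun ⟨a, ha⟩ i => ⟨a i, ha i⟩⟩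

theorem DefPred.and {φ ψ : (ι → 𝔤) → Prop} (hφ : P.DefPred φ) (hψ : P.DefPred ψ) :
    P.DefPred fun a => φ a ∧ ψ a := by
  refine Set.Definable.congr
      (Set.Definable.inter hφ hψ) fun p => ?_
  constructor
  · rintro ⟨⟨a, ha, h1⟩, b, hb, h2⟩
    obtain rfl := ha.unique hb
    exact ⟨a, ha, h1, h2⟩
  · rintro ⟨a, ha, h1, h2⟩
    exact ⟨⟨a, ha, h1⟩, a, ha, h2⟩

/-- The complement is taken within the tuples that represent something; uniqueness of the
represented tuple makes it the negation. -/
theorem DefPred.not [Finite ι] {φ : (ι → 𝔤) → Prop} (hφ : P.DefPred φ) :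
    P.DefPred fun a => ¬ φ a := by
  refine Set.Definable.congr
      (Set.Definable.sdiff defPred_true hφ) fun p => ?_
  constructor
  · rintro ⟨⟨a, ha, -⟩, h⟩
    exact ⟨a, ha, fun h' => h ⟨a, ha, h'⟩⟩
  · rintro ⟨a, ha, h⟩
    refine ⟨⟨a, ha, trivial⟩, ?_⟩
    rintro ⟨b, hb, h'⟩
    obtain rfl := ha.unique hb
    exact h h'

theorem DefPred.reindex [Finite κ] {φ : (ι → 𝔤) → Prop} (hφ : P.DefPred φ) (f : ι → κ) :
    P.DefPred fun a : κ → 𝔤 => φ (a ∘ f) := by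
  refine Set.Definable.congr
      (Set.Definable.inter (defPred_true (ι := κ))
    (hφ.preimage_comp (Prod.map f (id : Fin P.arity → Fin P.arity)))) fun p => ?_
  constructor
  · rintro ⟨⟨a, ha, -⟩, b, hb, h⟩
    obtain rfl : b = a ∘ f := hb.unique fun i => ha (f i)
    exact ⟨a, ha, h⟩
  · rintro ⟨a, ha, h⟩
    exact ⟨⟨a, ha, trivial⟩, a ∘ f, fun i => ha (f i), h⟩

theorem DefPred.exists [Finite ι] {φ : (Option ι → 𝔤) → Prop} (hφ : P.DefPred φ) :
    P.DefPred fun a : ι → 𝔤 => ∃ b, φ (fun o => o.elim b a) := by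
  refine Set.Definable.congr
      (hφ.image_comp (Prod.map some id : ι × Fin P.arity → Option ι × Fin P.arity)) fun p => ?_
  constructor
  · rintro ⟨q, ⟨a, ha, h⟩, rfl⟩
    refine ⟨a ∘ some, fun i => ha (some i), a none, ?_⟩
    convert h using 1
    funext o
    cases o <;> rfl
  · rintro ⟨a, ha, b, h⟩
    obtain ⟨q, hq⟩ := exists_cls_eq (P := P) b
    refine ⟨fun oj => oj.1.elim (q oj.2) fun i => p (i, oj.2), ⟨_, ?_, h⟩, rfl⟩
    rintro (_ | i)
    · exact hq
    · exact ha i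

theorem DefPred.forall [Finite ι] {φ : (Option ι → 𝔤) → Prop} (hφ : P.DefPred φ) :
    P.DefPred fun a : ι → 𝔤 => ∀ b, φ (fun o => o.elim b a) :=
  hφ.not.exists.not.congr fun a => by simp

theorem defPred_mem_iff {X : Set 𝔤} :
    P.DefPred (fun a : Unit → 𝔤 => a () ∈ X) ↔ P.IsDefinable X := by
  constructor
  · intro h
    refine Set.Definable.congr
      (h.preimage_comp (Prod.snd : Unit × Fin P.arity → Fin P.arity)) fun p => ?_
    constructor
    · rintro ⟨a, ha, h⟩
      exact ⟨a (), h, ha ()⟩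
    · rintro ⟨a, h, ha⟩
      exact ⟨fun _ => a, fun _ => ha, h⟩
  · intro h
    refine Set.Definable.congr
      (h.preimage_comp fun j => (((), j) : Unit × Fin P.arity)) fun p => ?_
    constructor
    · rintro ⟨a, h, ha⟩
      exact ⟨fun _ => a, fun _ => ha, h⟩
    · rintro ⟨a, ha, h⟩
      exact ⟨a (), h, ha ()⟩

theorem defPred_eq [Finite ι] (i j : ι) : P.DefPred fun a : ι → 𝔤 => a i = a j := by
  refine Set.Definable.congr
      (Set.Definable.inter (defPred_true (ι := ι))
    (P.sort.definable_rel.preimage_comp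
      (Sum.elim (fun k => (i, k)) fun k => ((j, k) : ι × Fin P.arity)))) fun p => ?_
  constructor
  · rintro ⟨⟨a, ha, -⟩, h⟩
    refine ⟨a, ha, P.coord_injective ?_⟩
    rw [ha i, ha j]
    exact Quotient.sound h
  · rintro ⟨a, ha, h⟩
    refine ⟨⟨a, ha, trivial⟩, ?_⟩
    have := (ha i).symm.trans ((congrArg P.coord h).trans (ha j))
    exact Quotient.exact this

theorem defPred_add : P.DefPred fun a : Fin 3 → 𝔤 => a 0 + a 1 = a 2 := by
  refine Set.Definable.congr
      P.definable_add fun p => ?_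
  constructor
  · rintro ⟨a, b, h0, h1, h2⟩
    exact ⟨![a, b, a + b], fun i => by fin_cases i <;> assumption, rfl⟩
  · rintro ⟨a, ha, h⟩
    exact ⟨a 0, a 1, ha 0, ha 1, h ▸ ha 2⟩

theorem defPred_lie : P.DefPred fun a : Fin 3 → 𝔤 => ⁅a 0, a 1⁆ = a 2 := by
  refine Set.Definable.congr
      P.definable_bracket fun p => ?_
  constructor
  · rintro ⟨a, b, h0, h1, h2⟩
    exact ⟨![a, b, ⁅a, b⁆], fun i => by fin_cases i <;> assumption, rfl⟩
  · rintro ⟨a, ha, h⟩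
    exact ⟨a 0, a 1, ha 0, ha 1, h ▸ ha 2⟩

variable (P)

/-- Definable functions from tuples of elements of the Lie ring to the Lie ring. -/
def DefTerm (t : (ι → 𝔤) → 𝔤) : Prop :=
  P.DefPred fun a : Option ι → 𝔤 => a none = t (a ∘ some)

variable {P}

theorem DefPred.subst [Finite ι] {φ : (Option ι → 𝔤) → Prop} {t : (ι → 𝔤) → 𝔤}
    (hφ : P.DefPred φ) (ht : P.DefTerm t) : P.DefPred fun a => φ (fun o => o.elim (t a) a) := by
  refine (DefPred.and ht hφ).exists.congr fun a => ?_
  constructor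
  · rintro ⟨b, hb, h⟩
    obtain rfl : b = t a := hb
    exact h
  · exact fun h => ⟨t a, rfl, h⟩

theorem DefTerm.mem [Finite ι] {t : (ι → 𝔤) → 𝔤} (ht : P.DefTerm t) {X : Set 𝔤}
    (hX : P.IsDefinable X) : P.DefPred fun a => t a ∈ X :=
  ((defPred_mem_iff.2 hX).reindex fun _ => (none : Option ι)).subst ht

theorem defTerm_var [Finite ι] (i : ι) : P.DefTerm fun a : ι → 𝔤 => a i :=
  defPred_eq none (some i)

theorem DefTerm.reindex [Finite κ] {t : (ι → 𝔤) → 𝔤} (ht : P.DefTerm t) (f : ι → κ) :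
    P.DefTerm fun a : κ → 𝔤 => t (a ∘ f) :=
  DefPred.reindex ht (Option.map f)

theorem DefTerm.eq [Finite ι] {s t : (ι → 𝔤) → 𝔤} (hs : P.DefTerm s) (ht : P.DefTerm t) :
    P.DefPred fun a => s a = t a :=
  DefPred.subst ht hs

/-- In the three nested options, `none` and `some none` hold the values of `s` and `t`, which are
substituted away in turn, and `some (some none)` holds the result. -/
theorem DefTerm.comp₂ [Finite ι] {op : 𝔤 → 𝔤 → 𝔤}
    (hop : P.DefPred fun a : Fin 3 → 𝔤 => op (a 0) (a 1) = a 2) {s t : (ι → 𝔤) → 𝔤}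
    (hs : P.DefTerm s) (ht : P.DefTerm t) : P.DefTerm fun a => op (s a) (t a) := by
  have h1 := (hop.reindex ![none, some none, some (some none)] :
    P.DefPred fun a : Option (Option (Option ι)) → 𝔤 => _)
  have h2 := h1.subst (t := fun a => s (a ∘ (some ∘ some))) (hs.reindex _)
  have h3 := h2.subst (t := fun a => t (a ∘ some)) (ht.reindex _)
  exact h3.congr fun a => eq_comm

theorem DefTerm.add [Finite ι] {s t : (ι → 𝔤) → 𝔤} (hs : P.DefTerm s) (ht : P.DefTerm t) :
    P.DefTerm fun a => s a + t a :=
  DefTerm.comp₂ defPred_add hs ht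

theorem DefTerm.sub [Finite ι] {s t : (ι → 𝔤) → 𝔤} (hs : P.DefTerm s) (ht : P.DefTerm t) :
    P.DefTerm fun a => s a - t a :=
  DefTerm.comp₂ ((defPred_add.reindex ![2, 1, 0]).congr fun a => by
    simp [eq_comm, sub_eq_iff_eq_add]) hs ht

theorem DefTerm.lie [Finite ι] {s t : (ι → 𝔤) → 𝔤} (hs : P.DefTerm s) (ht : P.DefTerm t) :
    P.DefTerm fun a => ⁅s a, t a⁆ :=
  DefTerm.comp₂ defPred_lie hs ht

theorem definable_cls_eq {n : ℕ} (S : L.ImaginarySort M n) (q : Fin n → M) :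
    (Set.univ : Set M).Definable L {p : Fin n → M | S.cls q = S.cls p} := by
  have h0 : ∀ i : Fin n, (Set.univ : Set M).Definable L
      {p : Fin n ⊕ Fin n → M | p (Sum.inl i) = q i} := fun i =>
    (Set.Definable.singleton_of_mem L (Set.mem_univ (q i))).preimage_comp
      (fun _ : Fin 1 => (Sum.inl i : Fin n ⊕ Fin n))
  refine Set.Definable.congr
      (((Set.definable_iInter_of_finite h0).inter S.definable_rel).image_comp
      (Sum.inr : Fin n → Fin n ⊕ Fin n)) fun p => ?_
  constructor
  · rintro ⟨r, ⟨h1, h2⟩, rfl⟩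
    have : r ∘ Sum.inl = q := funext fun i => Set.mem_iInter.1 h1 i
    rw [← this]
    exact Quotient.sound h2
  · intro h
    exact ⟨Sum.elim q p, ⟨Set.mem_iInter.2 fun i => rfl, Quotient.exact h⟩, rfl⟩

theorem isDefinable_singleton (c : 𝔤) : P.IsDefinable {c} := by
  obtain ⟨q, hq⟩ := exists_cls_eq (P := P) c
  refine Set.Definable.congr
      (definable_cls_eq P.sort q) fun p => ?_
  simp [hq, eq_comm]

theorem defTerm_const [Finite ι] (c : 𝔤) : P.DefTerm fun _ : ι → 𝔤 => c :=
  (defTerm_var none).mem (isDefinable_singleton c)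

end Definability

end FirstOrder.Language.LieRingPresentation

namespace FirstOrder.Language.LieRingPresentation

variable {L : Language.{u, v}} {M : Type w} [L.Structure M] {𝔤 : Type x} [LieRing 𝔤]
  (P : L.LieRingPresentation M 𝔤)

/-! ### Sets interpretable in the Lie ring -/

/-- A presentation of `V` as the quotient of a power of the Lie ring by a definable equivalence
relation. -/
structure Coding (V : Type*) where
  length : ℕ
  proj : (Fin length → 𝔤) → V
  surjective : Function.Surjective proj
  definable_ker : P.DefPred fun a : Fin length ⊕ Fin length → 𝔤 =>
    proj (a ∘ Sum.inl) = proj (a ∘ Sum.inr)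

namespace Coding

variable {P} {V W : Type*} (C : P.Coding V) (C' : P.Coding W)

/-- The definable subsets of `V`. -/
def Def (X : Set V) : Prop := P.DefPred fun a => C.proj a ∈ X

/-- The definable maps from `V` to `W`. -/
def DefMap (f : V → W) : Prop :=
  P.DefPred fun a : Fin C.length ⊕ Fin C'.length → 𝔤 => f (C.proj (a ∘ Sum.inl)) = C'.proj (a ∘ Sum.inr)

/-- The element of `V` represented by `p` is `v`. -/
def Rep (p : Fin (C.length * P.arity) → M) (v : V) : Prop :=
  ∃ a, P.Represents (p ∘ finProdFinEquiv) a ∧ C.proj a = v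

variable {C} in
theorem Rep.unique {p : Fin (C.length * P.arity) → M} {v v' : V} (h : C.Rep p v)
    (h' : C.Rep p v') : v = v' := by
  obtain ⟨a, ha, rfl⟩ := h
  obtain ⟨b, hb, rfl⟩ := h'
  rw [ha.unique hb]

theorem exists_rep (v : V) : ∃ p, C.Rep p v := by
  obtain ⟨a, rfl⟩ := C.surjective v
  obtain ⟨p, hp⟩ := exists_represents (P := P) a
  refine ⟨p ∘ finProdFinEquiv.symm, a, ?_, rfl⟩
  intro i
  simpa using hp i

theorem definable_rep_mem {X : Set V} (hX : C.Def X) {β : Type*}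
    (e : Fin (C.length * P.arity) → β) :
    (Set.univ : Set M).Definable L {p : β → M | ∃ v ∈ X, C.Rep (p ∘ e) v} := by
  refine (hX.preimage_comp (e ∘ finProdFinEquiv)).congr fun p => ?_
  constructor
  · rintro ⟨a, ha, h⟩
    exact ⟨_, h, a, ha, rfl⟩
  · rintro ⟨_, h, a, ha, rfl⟩
    exact ⟨a, ha, h⟩

theorem definable_rep_rep {φ : V → W → Prop}
    (hφ : P.DefPred fun a : Fin C.length ⊕ Fin C'.length → 𝔤 =>
      φ (C.proj (a ∘ Sum.inl)) (C'.proj (a ∘ Sum.inr))) :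
    (Set.univ : Set M).Definable L
      {p : Fin (C.length * P.arity) ⊕ Fin (C'.length * P.arity) → M |
        ∃ v w, C.Rep (p ∘ Sum.inl) v ∧ C'.Rep (p ∘ Sum.inr) w ∧ φ v w} := by
  refine (hφ.preimage_comp (fun ij : (Fin C.length ⊕ Fin C'.length) × Fin P.arity =>
    (ij.1.elim (fun i => Sum.inl (finProdFinEquiv (i, ij.2)))
      fun i => Sum.inr (finProdFinEquiv (i, ij.2)) :
        Fin (C.length * P.arity) ⊕ Fin (C'.length * P.arity)))).congr fun p => ?_
  constructor
  · rintro ⟨a, ha, h⟩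
    exact ⟨_, _, ⟨a ∘ Sum.inl, fun i => ha (Sum.inl i), rfl⟩,
      ⟨a ∘ Sum.inr, fun i => ha (Sum.inr i), rfl⟩, h⟩
  · rintro ⟨_, _, ⟨a, ha, rfl⟩, ⟨b, hb, rfl⟩, h⟩
    refine ⟨Sum.elim a b, ?_, h⟩
    rintro (i | i)
    · exact ha i
    · exact hb i

theorem def_univ : C.Def Set.univ := defPred_true.congr fun a => by simp

/-- The sort of imaginaries coding `V`. The tuples which represent no element form a class. -/
def sort : L.ImaginarySort M (C.length * P.arity) where
  rel :=
    { r := fun p q => ∀ v, C.Rep p v ↔ C.Rep q v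
      iseqv := ⟨fun _ _ => Iff.rfl, fun h v => (h v).symm, fun h h' v => (h v).trans (h' v)⟩ }
  definable_rel := by
    have h1 := C.definable_rep_rep C (φ := fun v w => v = w) C.definable_ker
    have h2 := C.definable_rep_mem C.def_univ
      (Sum.inl : _ → Fin (C.length * P.arity) ⊕ Fin (C.length * P.arity))
    have h3 := C.definable_rep_mem C.def_univ
      (Sum.inr : _ → Fin (C.length * P.arity) ⊕ Fin (C.length * P.arity))
    refine (h1.union (h2.compl.inter h3.compl)).congr fun p => ?_
    constructor
    · rintro (⟨v, _, hv, hw, rfl⟩ | ⟨h, h'⟩) v'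
      · constructor
        · intro h
          rwa [h.unique hv]
        · intro h
          rwa [h.unique hw]
      · exact ⟨fun hv => (h ⟨v', trivial, hv⟩).elim, fun hv => (h' ⟨v', trivial, hv⟩).elim⟩
    · intro h
      by_cases hv : ∃ v, C.Rep (p ∘ Sum.inl) v
      · obtain ⟨v, hv⟩ := hv
        exact Or.inl ⟨v, v, hv, (h v).1 hv, rfl⟩
      · refine Or.inr ⟨fun ⟨v, _, h'⟩ => hv ⟨v, h'⟩, fun ⟨v, _, h'⟩ => hv ⟨v, (h v).2 h'⟩⟩

/-- The imaginary coding an element of `V`. -/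
noncomputable def coord (v : V) : C.sort.Elem := C.sort.cls (C.exists_rep v).choose

theorem coord_eq_cls {v : V} {p : Fin (C.length * P.arity) → M} :
    C.coord v = C.sort.cls p ↔ C.Rep p v := by
  have hv := (C.exists_rep v).choose_spec
  constructor
  · intro h
    exact ((Quotient.exact h : ∀ v, _ ↔ _) v).1 hv
  · intro h
    refine Quotient.sound (s := C.sort.rel) (fun v' => ⟨fun h' => ?_, fun h' => ?_⟩)
    · rwa [h'.unique hv]
    · rwa [h'.unique h]

theorem coord_injective : Function.Injective C.coord := by
  intro v v' h
  exact (C.coord_eq_cls.1 h).unique (C.exists_rep v').choose_spec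

theorem isInterpretable {X : Set V} (hX : C.Def X) : C.sort.IsInterpretable (C.coord '' X) :=
  (C.definable_rep_mem hX id).congr fun p => by
    simp only [Set.mem_ofPred_eq, Set.mem_image, coord_eq_cls, Function.comp_id]

/-- The map induced by `f` between coded sets. -/
noncomputable def codedMap {X : Set V} {Y : Set W} {f : V → W} (hf : Set.MapsTo f X Y) :
    (C.coord '' X) → (C'.coord '' Y) :=
  fun s => ⟨C'.coord (f s.2.choose), Set.mem_image_of_mem _ (hf s.2.choose_spec.1)⟩

theorem codedMap_coord {X : Set V} {Y : Set W} {f : V → W} (hf : Set.MapsTo f X Y) {v : V}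
    (hv : v ∈ X) :
    C.codedMap C' hf ⟨C.coord v, Set.mem_image_of_mem _ hv⟩ =
      ⟨C'.coord (f v), Set.mem_image_of_mem _ (hf hv)⟩ := by
  have h : C.coord v ∈ C.coord '' X := Set.mem_image_of_mem _ hv
  refine Subtype.ext ?_
  change C'.coord (f h.choose) = _
  rw [C.coord_injective h.choose_spec.2]

theorem isInterpretableFun {X : Set V} {Y : Set W} {f : V → W} (hf : Set.MapsTo f X Y)
    (hX : C.Def X) (df : C.DefMap C' f) :
    ImaginarySort.IsInterpretableFun (C.codedMap C' hf) := by
  have h := C.definable_rep_rep C' (φ := fun v w => v ∈ X ∧ f v = w)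
    ((hX.reindex Sum.inl).and df)
  refine h.congr fun p => ?_
  constructor
  · rintro ⟨v, _, hv, hw, hX, rfl⟩
    refine ⟨⟨_, Set.mem_image_of_mem _ hX⟩, C.coord_eq_cls.2 hv, ?_⟩
    rw [codedMap_coord _ _ _ hX]
    exact C'.coord_eq_cls.2 hw
  · rintro ⟨⟨_, v, hv, rfl⟩, h1, h2⟩
    rw [codedMap_coord _ _ _ hv] at h2
    exact ⟨v, f v, C.coord_eq_cls.1 h1, C'.coord_eq_cls.1 h2, hv, rfl⟩

theorem codedMap_fiber {X : Set V} {Y : Set W} {f : V → W} (hf : Set.MapsTo f X Y) {w : W}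
    (hw : w ∈ Y) :
    Subtype.val '' (C.codedMap C' hf ⁻¹' {⟨C'.coord w, Set.mem_image_of_mem _ hw⟩}) =
      C.coord '' (X ∩ f ⁻¹' {w}) := by
  ext s
  constructor
  · rintro ⟨⟨_, v, hv, rfl⟩, h, rfl⟩
    rw [Set.mem_preimage, Set.mem_singleton_iff, codedMap_coord _ _ _ hv] at h
    exact ⟨v, ⟨hv, C'.coord_injective (Subtype.ext_iff.1 h)⟩, rfl⟩
  · rintro ⟨v, ⟨hv, rfl⟩, rfl⟩
    exact ⟨⟨_, Set.mem_image_of_mem _ hv⟩, C.codedMap_coord C' hf hv, rfl⟩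

end Coding

/-! ### Dimension of the interpretable sets of a single model -/

/-- The properties of the dimension in a single model. -/
structure _root_.FirstOrder.Language.IsDimensionOn (L : Language.{u, v}) (M : Type w)
    [L.Structure M] (dim : ∀ (n : ℕ) (S : L.ImaginarySort M n), Set S.Elem → WithBot ℕ) :
    Prop where
  dim_eq_zero_iff : ∀ (n : ℕ) (S : L.ImaginarySort M n) (X : Set S.Elem), S.IsInterpretable X →
    X.Nonempty → (dim n S X = 0 ↔ X.Finite)
  dim_union : ∀ (n : ℕ) (S : L.ImaginarySort M n) (X Y : Set S.Elem), S.IsInterpretable X →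
    S.IsInterpretable Y → dim n S (X ∪ Y) = max (dim n S X) (dim n S Y)
  le_dim_of_le_dim_fiber : ∀ (n m : ℕ) (S : L.ImaginarySort M n) (S' : L.ImaginarySort M m)
    (X : Set S.Elem) (Y : Set S'.Elem) (f : X → Y) (k : ℕ), S.IsInterpretable X →
      S'.IsInterpretable Y → ImaginarySort.IsInterpretableFun f →
      (∀ y : Y, (k : WithBot ℕ) ≤ dim n S (Subtype.val '' (f ⁻¹' {y}))) →
      dim m S' Y + k ≤ dim n S X
  dim_le_of_dim_fiber_le : ∀ (n m : ℕ) (S : L.ImaginarySort M n) (S' : L.ImaginarySort M m)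
    (X : Set S.Elem) (Y : Set S'.Elem) (f : X → Y) (k : ℕ), S.IsInterpretable X →
      S'.IsInterpretable Y → ImaginarySort.IsInterpretableFun f →
      (∀ y : Y, dim n S (Subtype.val '' (f ⁻¹' {y})) ≤ (k : WithBot ℕ)) →
      dim n S X ≤ dim m S' Y + k

variable {P} {dim : ∀ (n : ℕ) (S : L.ImaginarySort M n), Set S.Elem → WithBot ℕ}

namespace Coding

variable {V W : Type*} (C : P.Coding V) (C' : P.Coding W)

/-- The dimension of a subset of `V`. -/
noncomputable def cdim (dim : ∀ (n : ℕ) (S : L.ImaginarySort M n), Set S.Elem → WithBot ℕ)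
    (X : Set V) : WithBot ℕ :=
  dim _ C.sort (C.coord '' X)

variable (hdim : L.IsDimensionOn M dim)
include hdim

theorem cdim_eq_zero_iff {X : Set V} (hX : C.Def X) (hne : X.Nonempty) :
    C.cdim dim X = 0 ↔ X.Finite := by
  rw [cdim, hdim.dim_eq_zero_iff _ _ _ (C.isInterpretable hX) (hne.image _),
    Set.finite_image_iff C.coord_injective.injOn]

theorem cdim_union {X Y : Set V} (hX : C.Def X) (hY : C.Def Y) :
    C.cdim dim (X ∪ Y) = max (C.cdim dim X) (C.cdim dim Y) := by
  rw [cdim, Set.image_union,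
    hdim.dim_union _ _ _ _ (C.isInterpretable hX) (C.isInterpretable hY)]
  rfl

theorem cdim_mono {X Y : Set V} (hX : C.Def X) (hY : C.Def Y) (h : X ⊆ Y) :
    C.cdim dim X ≤ C.cdim dim Y := by
  rw [← Set.union_eq_self_of_subset_left h, C.cdim_union hdim hX hY]
  exact le_max_left _ _

theorem le_cdim_of_fiber {X : Set V} {Y : Set W} {f : V → W} (hf : Set.MapsTo f X Y)
    (hX : C.Def X) (hY : C'.Def Y) (df : C.DefMap C' f) (k : ℕ)
    (h : ∀ w ∈ Y, (k : WithBot ℕ) ≤ C.cdim dim (X ∩ f ⁻¹' {w})) :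
    C'.cdim dim Y + k ≤ C.cdim dim X := by
  refine hdim.le_dim_of_le_dim_fiber _ _ _ _ _ _ (C.codedMap C' hf) k (C.isInterpretable hX)
    (C'.isInterpretable hY) (C.isInterpretableFun C' hf hX df) ?_
  rintro ⟨_, w, hw, rfl⟩
  rw [codedMap_fiber _ _ _ hw]
  exact h w hw

theorem cdim_le_of_fiber {X : Set V} {Y : Set W} {f : V → W} (hf : Set.MapsTo f X Y)
    (hX : C.Def X) (hY : C'.Def Y) (df : C.DefMap C' f) (k : ℕ)
    (h : ∀ w ∈ Y, C.cdim dim (X ∩ f ⁻¹' {w}) ≤ k) :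
    C.cdim dim X ≤ C'.cdim dim Y + k := by
  refine hdim.dim_le_of_dim_fiber_le _ _ _ _ _ _ (C.codedMap C' hf) k (C.isInterpretable hX)
    (C'.isInterpretable hY) (C.isInterpretableFun C' hf hX df) ?_
  rintro ⟨_, w, hw, rfl⟩
  rw [codedMap_fiber _ _ _ hw]
  exact h w hw

omit hdim in
theorem isInterpretable_singleton (v : V) : C.sort.IsInterpretable {C.coord v} := by
  obtain ⟨q, hq⟩ := C.exists_rep v
  refine (definable_cls_eq C.sort q).congr fun p => ?_
  rw [← C.coord_eq_cls.2 hq, Set.mem_ofPred_eq, Set.mem_ofPred_eq, Set.mem_singleton_iff, eq_comm]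

theorem dim_singleton (v : V) : dim _ C.sort {C.coord v} = 0 :=
  (hdim.dim_eq_zero_iff _ _ _ (C.isInterpretable_singleton v) (Set.singleton_nonempty _)).2
    (Set.finite_singleton _)

theorem cdim_singleton (v : V) : C.cdim dim {v} = 0 := by
  rw [cdim, Set.image_singleton, C.dim_singleton hdim]

/-- The fibres are singletons, of dimension `0`, so both fibre inequalities apply with `k = 0`. -/
theorem cdim_eq_of_bijOn {X : Set V} {Y : Set W} {f : V → W} (hf : Set.BijOn f X Y)
    (hX : C.Def X) (hY : C'.Def Y) (df : C.DefMap C' f) : C.cdim dim X = C'.cdim dim Y := by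
  have h : ∀ w ∈ Y, C.cdim dim (X ∩ f ⁻¹' {w}) = ((0 : ℕ) : WithBot ℕ) := by
    intro w hw
    obtain ⟨v, hv, rfl⟩ := hf.surjOn hw
    have : X ∩ f ⁻¹' {f v} = {v} := by
      ext v'
      exact ⟨fun h' => hf.injOn h'.1 hv h'.2, fun h' => by rw [h']; exact ⟨hv, rfl⟩⟩
    rw [this, C.cdim_singleton hdim, Nat.cast_zero]
  have h1 := C.cdim_le_of_fiber C' hdim hf.mapsTo hX hY df 0 fun w hw => (h w hw).le
  have h2 := C.le_cdim_of_fiber C' hdim hf.mapsTo hX hY df 0 fun w hw => (h w hw).ge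
  rw [Nat.cast_zero, add_zero] at h1 h2
  exact le_antisymm h1 h2

theorem exists_cdim_eq {X : Set V} (hX : C.Def X) (hne : X.Nonempty) :
    ∃ n : ℕ, C.cdim dim X = n := by
  have h0 : (0 : WithBot ℕ) ≤ C.cdim dim X := by
    obtain ⟨v, hv⟩ := hne
    rw [← C.dim_singleton hdim v, cdim, ← Set.union_eq_self_of_subset_left
      (Set.singleton_subset_iff.2 (Set.mem_image_of_mem C.coord hv)),
      hdim.dim_union _ _ _ _ (C.isInterpretable_singleton v) (C.isInterpretable hX)]
    exact le_max_left _ _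
  obtain ⟨n, hn⟩ := WithBot.ne_bot_iff_exists.1 (ne_bot_of_le_ne_bot (by simp) h0)
  exact ⟨n, hn.symm⟩

end Coding

end FirstOrder.Language.LieRingPresentation

namespace FirstOrder.Language.LieRingPresentation

variable {L : Language.{u, v}} {M : Type w} [L.Structure M] {𝔤 : Type x} [LieRing 𝔤]
  {P : L.LieRingPresentation M 𝔤}

/-! ### Definable subgroups -/

theorem isDefinable_univ : P.IsDefinable Set.univ :=
  defPred_mem_iff.1 (defPred_true.congr fun _ => by simp)

theorem isDefinable_bot : P.IsDefinable (⊥ : AddSubgroup 𝔤) := by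
  rw [AddSubgroup.coe_bot]; exact isDefinable_singleton 0

theorem isDefinable_inf {H K : AddSubgroup 𝔤} (hH : P.IsDefinable H) (hK : P.IsDefinable K) :
    P.IsDefinable (H ⊓ K : AddSubgroup 𝔤) :=
  defPred_mem_iff.1 (((defTerm_var ()).mem hH).and ((defTerm_var ()).mem hK))

theorem isDefinable_sup {H K : AddSubgroup 𝔤} (hH : P.IsDefinable H) (hK : P.IsDefinable K) :
    P.IsDefinable (H ⊔ K : AddSubgroup 𝔤) := by
  refine defPred_mem_iff.1 ((((defTerm_var (none : Option Unit)).mem hH).and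
    (((defTerm_var (some ())).sub (defTerm_var none)).mem hK)).exists.congr fun a => ?_)
  rw [SetLike.mem_coe, AddSubgroup.mem_sup]
  constructor
  · rintro ⟨b, hb, hc⟩
    exact ⟨b, hb, _, hc, add_sub_cancel _ _⟩
  · rintro ⟨b, hb, c, hc, h⟩
    refine ⟨b, hb, ?_⟩
    simpa [← h] using hc

theorem isDefinable_map (x : 𝔤) {H : AddSubgroup 𝔤} (hH : P.IsDefinable H) :
    P.IsDefinable (H.map (adHom x)) :=
  defPred_mem_iff.1 ((((defTerm_var (none : Option Unit)).mem hH).and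
    (((defTerm_const x).lie (defTerm_var none)).eq (defTerm_var (some ())))).exists.congr
      fun _ => Iff.rfl)

theorem isDefinable_comap (x : 𝔤) {H : AddSubgroup 𝔤} (hH : P.IsDefinable H) :
    P.IsDefinable (H.comap (adHom x)) :=
  defPred_mem_iff.1 (((defTerm_const x).lie (defTerm_var ())).mem hH)

theorem isDefinable_lieTransporter {H : AddSubgroup 𝔤} (hH : P.IsDefinable H) :
    P.IsDefinable (lieTransporter H) :=
  defPred_mem_iff.1 ((((defTerm_var (none : Option Unit)).lie
    (defTerm_var (some ()))).mem hH).forall.congr fun _ => mem_lieTransporter.symm)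

/-! ### Codings of the Lie ring, of its square and of its quotients -/

/-- The Lie ring. -/
def selfCoding (P : L.LieRingPresentation M 𝔤) : P.Coding 𝔤 where
  length := 1
  proj a := a 0
  surjective c := ⟨fun _ => c, rfl⟩
  definable_ker := defPred_eq _ _

/-- The square of the Lie ring. -/
def pairCoding (P : L.LieRingPresentation M 𝔤) : P.Coding (𝔤 × 𝔤) where
  length := 2
  proj a := (a 0, a 1)
  surjective c := ⟨![c.1, c.2], rfl⟩
  definable_ker := ((defPred_eq (Sum.inl 0) (Sum.inr 0)).and
    (defPred_eq (Sum.inl 1) (Sum.inr 1))).congr fun _ => Prod.mk_inj.symm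

/-- The quotient by a definable subgroup. -/
def quotCoding {H : AddSubgroup 𝔤} (hH : P.IsDefinable H) : P.Coding (𝔤 ⧸ H) where
  length := 1
  proj a := QuotientAddGroup.mk (a 0)
  surjective c := by
    obtain ⟨y, rfl⟩ := QuotientAddGroup.mk_surjective c
    exact ⟨fun _ => y, rfl⟩
  definable_ker := (((defTerm_var (Sum.inr 0)).sub (defTerm_var (Sum.inl 0))).mem hH).congr
    fun a => by
      rw [QuotientAddGroup.eq, neg_add_eq_sub]; rfl

theorem selfCoding_def {X : Set 𝔤} (hX : P.IsDefinable X) : P.selfCoding.Def X :=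
  (defTerm_var (0 : Fin 1)).mem hX

variable {dim : ∀ (n : ℕ) (S : L.ImaginarySort M n), Set S.Elem → WithBot ℕ}
  (hdim : L.IsDimensionOn M dim)

/-- The dimension of a definable subgroup. -/
noncomputable def groupDim (P : L.LieRingPresentation M 𝔤)
    (dim : ∀ (n : ℕ) (S : L.ImaginarySort M n), Set S.Elem → WithBot ℕ)
    (H : AddSubgroup 𝔤) : ℕ :=
  -- The default value is never taken on a definable subgroup, which is nonempty.
  (P.selfCoding.cdim dim H).unbotD 0

include hdim

theorem cdim_eq_groupDim {H : AddSubgroup 𝔤} (hH : P.IsDefinable H) :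
    P.selfCoding.cdim dim H = P.groupDim dim H := by
  obtain ⟨n, hn⟩ := P.selfCoding.exists_cdim_eq hdim (selfCoding_def hH) ⟨0, H.zero_mem⟩
  rw [groupDim, hn]
  rfl

theorem groupDim_mono {H K : AddSubgroup 𝔤} (hH : P.IsDefinable H) (hK : P.IsDefinable K)
    (h : H ≤ K) : P.groupDim dim H ≤ P.groupDim dim K := by
  have := P.selfCoding.cdim_mono hdim (selfCoding_def hH) (selfCoding_def hK) h
  rw [cdim_eq_groupDim hdim hH, cdim_eq_groupDim hdim hK] at this
  exact_mod_cast this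

/-- The fibres of `K → K / H` are translates of `H`, so `dim K = dim (K / H) + dim H`, and `dim (K /
H) = 0` exactly when `K / H` is finite. -/
theorem groupDim_le_iff {H K : AddSubgroup 𝔤} (hH : P.IsDefinable H) (hK : P.IsDefinable K)
    (h : H ≤ K) : P.groupDim dim K ≤ P.groupDim dim H ↔ K.AlmostLE H := by
  set Y : Set (𝔤 ⧸ H) := ((K.map (QuotientAddGroup.mk' H) : AddSubgroup (𝔤 ⧸ H)) :
    Set (𝔤 ⧸ H)) with hYdef
  have hmem : ∀ a : 𝔤, (QuotientAddGroup.mk a : 𝔤 ⧸ H) ∈ Y ↔ a ∈ K := by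
    intro a
    rw [hYdef, SetLike.mem_coe, ← QuotientAddGroup.coe_mk' H, ← AddSubgroup.mem_comap,
      AddSubgroup.comap_map_eq, QuotientAddGroup.ker_mk', sup_eq_left.2 h]
  have hY : (quotCoding hH).Def Y :=
    ((defTerm_var (0 : Fin 1)).mem hK).congr fun a => (hmem (a 0)).symm
  have dX := selfCoding_def hK
  have hf : Set.MapsTo (QuotientAddGroup.mk : 𝔤 → 𝔤 ⧸ H) (K : Set 𝔤) Y := fun a ha => (hmem a).2 ha
  have df : P.selfCoding.DefMap (quotCoding hH) QuotientAddGroup.mk :=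
    (((defTerm_var (Sum.inr (0 : Fin 1))).sub (defTerm_var (Sum.inl (0 : Fin 1)))).mem hH).congr
      fun a => by
        rw [← neg_add_eq_sub]
        exact QuotientAddGroup.eq.symm
  have hfib : ∀ y ∈ Y, P.selfCoding.cdim dim ((K : Set 𝔤) ∩ QuotientAddGroup.mk ⁻¹' {y}) =
      (P.groupDim dim H : WithBot ℕ) := by
    rintro _ ⟨k, hk, rfl⟩
    rw [← cdim_eq_groupDim hdim hH]
    symm
    have hX' : P.IsDefinable ((K : Set 𝔤) ∩ QuotientAddGroup.mk ⁻¹' {QuotientAddGroup.mk' H k}) :=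
      defPred_mem_iff.1 ((((defTerm_var ()).mem hK).and
        (((defTerm_const k).sub (defTerm_var ())).mem hH)).congr fun a => by
          rw [← neg_add_eq_sub]
          exact Iff.and Iff.rfl QuotientAddGroup.eq.symm)
    refine P.selfCoding.cdim_eq_of_bijOn P.selfCoding hdim (f := fun y => k + y) ⟨?_, ?_, ?_⟩
      (selfCoding_def hH) (selfCoding_def hX') ?_
    · intro y hy
      exact ⟨K.add_mem hk (h hy), (QuotientAddGroup.mk_add_of_mem k hy)⟩
    · exact (add_right_injective k).injOn
    · rintro z ⟨hz, hz'⟩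
      refine ⟨-k + z, QuotientAddGroup.eq.1 (Eq.symm hz'), add_neg_cancel_left k z⟩
    · exact ((defTerm_const k).add (defTerm_var (Sum.inl (0 : Fin 1)))).eq
        (defTerm_var (Sum.inr (0 : Fin 1)))
  have hne : Y.Nonempty := ⟨_, (hmem 0).2 K.zero_mem⟩
  obtain ⟨n, hn⟩ := (quotCoding hH).exists_cdim_eq hdim hY hne
  have h1 := P.selfCoding.cdim_le_of_fiber _ hdim hf dX hY df _ fun y hy => (hfib y hy).le
  have h2 := P.selfCoding.le_cdim_of_fiber _ hdim hf dX hY df _ fun y hy => (hfib y hy).ge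
  rw [cdim_eq_groupDim hdim hK, hn] at h1 h2
  have h1' : P.groupDim dim K ≤ n + P.groupDim dim H := by exact_mod_cast h1
  have h2' : n + P.groupDim dim H ≤ P.groupDim dim K := by exact_mod_cast h2
  have h3 := (quotCoding hH).cdim_eq_zero_iff hdim hY hne
  rw [hn] at h3
  have h4 : n = 0 ↔ Y.Finite := by rw [← h3]; exact_mod_cast Iff.rfl
  have h5 : K.AlmostLE H ↔ Y.Finite := by
    have h6 : H.relIndex K = Nat.card Y := by
      conv_lhs => rw [← QuotientAddGroup.ker_mk' H]
      exact AddSubgroup.relIndex_ker _ _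
    have := hne.to_subtype
    rw [AlmostLE, h6, Nat.card_ne_zero, Set.finite_coe_iff]
    exact and_iff_right this
  rw [h5, ← h4]
  omega

omit hdim in
theorem defMap_fst : P.pairCoding.DefMap P.selfCoding Prod.fst :=
  defPred_eq (Sum.inl (0 : Fin 2)) (Sum.inr (0 : Fin 1))

omit hdim in
theorem defMap_snd : P.pairCoding.DefMap P.selfCoding Prod.snd :=
  defPred_eq (Sum.inl (1 : Fin 2)) (Sum.inr (0 : Fin 1))

/-- The dimension of a fibre of the first projection. -/
theorem cdim_fiber_fst {Z : Set (𝔤 × 𝔤)} {x : 𝔤} {H : AddSubgroup 𝔤} (hZ : P.pairCoding.Def Z)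
    (hH : P.IsDefinable H) (h : ∀ c, (x, c) ∈ Z ↔ c ∈ H) :
    P.pairCoding.cdim dim (Z ∩ Prod.fst ⁻¹' {x}) = P.groupDim dim H := by
  rw [← cdim_eq_groupDim hdim hH]
  refine P.pairCoding.cdim_eq_of_bijOn P.selfCoding hdim (f := Prod.snd) ⟨?_, ?_, ?_⟩
    (hZ.and ((defTerm_var (0 : Fin 2)).eq (defTerm_const x))) (selfCoding_def hH) defMap_snd
  · rintro ⟨_, c⟩ ⟨hc, rfl⟩
    exact (h c).1 hc
  · rintro ⟨_, c⟩ ⟨-, rfl⟩ ⟨_, c'⟩ ⟨-, h2⟩ rfl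
    exact Prod.ext h2.symm rfl
  · exact fun c hc => ⟨(x, c), ⟨(h c).2 hc, rfl⟩, rfl⟩

/-- The dimension of a fibre of the second projection. -/
theorem cdim_fiber_snd {Z : Set (𝔤 × 𝔤)} {c : 𝔤} {H : AddSubgroup 𝔤} (hZ : P.pairCoding.Def Z)
    (hH : P.IsDefinable H) (h : ∀ x, (x, c) ∈ Z ↔ x ∈ H) :
    P.pairCoding.cdim dim (Z ∩ Prod.snd ⁻¹' {c}) = P.groupDim dim H := by
  rw [← cdim_eq_groupDim hdim hH]
  refine P.pairCoding.cdim_eq_of_bijOn P.selfCoding hdim (f := Prod.fst) ⟨?_, ?_, ?_⟩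
    (hZ.and ((defTerm_var (1 : Fin 2)).eq (defTerm_const c))) (selfCoding_def hH) defMap_fst
  · rintro ⟨x, _⟩ ⟨hx, rfl⟩
    exact (h x).1 hx
  · rintro ⟨x, _⟩ ⟨-, rfl⟩ ⟨x', _⟩ ⟨-, h2⟩ rfl
    exact Prod.ext rfl h2.symm
  · exact fun x hx => ⟨(x, c), ⟨(h x).2 hx, rfl⟩, rfl⟩

/-- The dimension of `Z = {(x, c) | c ∈ C, [x, c] ∈ D}` is computed twice. Fibres over `x` have
finite index in `C`, so `dim Z ≥ dim 𝔤 + dim C`. Fibres over `c` are `𝔤` when `c` lies in the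
transporter, and of smaller dimension otherwise. So the part over the transporter must account for
the whole dimension. -/
theorem almostLE_lieTransporter (hconn : IsDefinablyConnected P.IsDefinable (⊤ : AddSubgroup 𝔤))
    {C D : AddSubgroup 𝔤} (hC : P.IsDefinable C) (hD : P.IsDefinable D)
    (h : ∀ x : 𝔤, C.AlmostLE (D.comap (adHom x))) : C.AlmostLE (lieTransporter D) := by
  by_cases hCT : C ≤ lieTransporter D
  · exact almostLE_of_le hCT
  have hT := isDefinable_lieTransporter hD
  have hC₀ := isDefinable_inf hC hT
  have htop : P.IsDefinable ((⊤ : AddSubgroup 𝔤) : Set 𝔤) := isDefinable_univ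
  -- Equal dimension would mean finite index in the connected `𝔤`, hence `[𝔤, c] ⊆ D`.
  have hstab : ∀ c ∉ lieTransporter D,
      P.groupDim dim (D.comap (adHom c)) < P.groupDim dim (⊤ : AddSubgroup 𝔤) := by
    intro c hc
    refine lt_of_not_ge fun hge => hc (mem_lieTransporter.2 fun x => ?_)
    have hd := isDefinable_comap c hD
    have h1 := hconn _ le_top hd ⟨(groupDim_le_iff hdim hd htop le_top).1 hge⟩
    have h2 : x ∈ D.comap (adHom c) := h1 ▸ AddSubgroup.mem_top x
    rw [← lie_skew, neg_mem_iff]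
    exact h2
  -- This makes the truncated subtraction `dim 𝔤 - 1` below an honest one.
  have hγ : 1 ≤ P.groupDim dim (⊤ : AddSubgroup 𝔤) := by
    obtain ⟨c, -, hc⟩ := SetLike.not_le_iff_exists.1 hCT
    exact (Nat.zero_le _).trans_lt (hstab c hc)
  let Z : Set (𝔤 × 𝔤) := {z | z.2 ∈ C ∧ ⁅z.1, z.2⁆ ∈ D}
  let Z₀ : Set (𝔤 × 𝔤) := {z | z.2 ∈ C ⊓ lieTransporter D}
  let Z₁ : Set (𝔤 × 𝔤) := {z | (z.2 ∈ C ∧ ⁅z.1, z.2⁆ ∈ D) ∧ z.2 ∉ lieTransporter D}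
  have dZ : P.pairCoding.Def Z := ((defTerm_var (1 : Fin 2)).mem hC).and
    (((defTerm_var (0 : Fin 2)).lie (defTerm_var 1)).mem hD)
  have dZ₀ : P.pairCoding.Def Z₀ := (defTerm_var (1 : Fin 2)).mem hC₀
  have dZ₁ : P.pairCoding.Def Z₁ := DefPred.and dZ ((defTerm_var (1 : Fin 2)).mem hT).not
  have dCT : P.selfCoding.Def ((C : Set 𝔤) \ lieTransporter D) :=
    ((defTerm_var (0 : Fin 1)).mem hC).and ((defTerm_var (0 : Fin 1)).mem hT).not
  have hZ : Z = Z₀ ∪ Z₁ := by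
    ext z
    constructor
    · intro hz
      by_cases hz' : z.2 ∈ lieTransporter D
      · exact Or.inl ⟨hz.1, hz'⟩
      · exact Or.inr ⟨hz, hz'⟩
    · rintro (hz | hz)
      · exact ⟨hz.1, mem_lieTransporter.1 hz.2 _⟩
      · exact hz.1
  have e : P.selfCoding.cdim dim (⊤ : AddSubgroup 𝔤) + P.groupDim dim C ≤
      P.pairCoding.cdim dim Z := by
    refine P.pairCoding.le_cdim_of_fiber P.selfCoding hdim (f := Prod.fst)
      (fun _ _ => AddSubgroup.mem_top _) dZ (selfCoding_def htop) defMap_fst _ fun x _ => ?_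
    have hd := isDefinable_inf (isDefinable_comap x hD) hC
    rw [cdim_fiber_fst hdim dZ hd fun c => and_comm]
    exact_mod_cast (groupDim_le_iff hdim hd hC inf_le_right).2 (h x).inf_self
  have e₀ : P.pairCoding.cdim dim Z₀ ≤
      P.selfCoding.cdim dim (C ⊓ lieTransporter D : AddSubgroup 𝔤) +
        P.groupDim dim (⊤ : AddSubgroup 𝔤) := by
    refine P.pairCoding.cdim_le_of_fiber P.selfCoding hdim (X := Z₀)
      (f := Prod.snd) (fun _ hz => hz) dZ₀ (selfCoding_def hC₀) defMap_snd _ fun c hc => ?_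
    rw [cdim_fiber_snd hdim dZ₀ htop fun x => iff_of_true hc (AddSubgroup.mem_top x)]
  have e₁ : P.pairCoding.cdim dim Z₁ ≤ P.selfCoding.cdim dim ((C : Set 𝔤) \ lieTransporter D) +
      (P.groupDim dim (⊤ : AddSubgroup 𝔤) - 1 : ℕ) := by
    refine P.pairCoding.cdim_le_of_fiber P.selfCoding hdim (X := Z₁)
      (Y := (C : Set 𝔤) \ lieTransporter D) (f := Prod.snd) (fun _ hz => ⟨hz.1.1, hz.2⟩) dZ₁ dCT defMap_snd _ fun c hc => ?_
    rw [cdim_fiber_snd hdim dZ₁ (isDefinable_comap c hD) fun x => ?_]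
    · exact_mod_cast Nat.le_sub_one_of_lt (hstab c hc.2)
    · rw [AddSubgroup.mem_comap, adHom_apply, ← lie_skew, neg_mem_iff]
      exact ⟨fun hx => hx.1.2, fun hx => ⟨⟨hc.1, hx⟩, hc.2⟩⟩
  have e₂ := P.selfCoding.cdim_mono hdim dCT (selfCoding_def hC) Set.sdiff_subset
  rw [hZ, P.pairCoding.cdim_union hdim dZ₀ dZ₁, le_max_iff] at e
  rw [cdim_eq_groupDim hdim htop] at e
  rw [cdim_eq_groupDim hdim hC₀] at e₀
  rw [cdim_eq_groupDim hdim hC] at e₂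
  refine AlmostLE.mono ((groupDim_le_iff hdim hC₀ hC inf_le_left).1 ?_) le_rfl inf_le_right
  rcases e with e | e
  · have := e.trans e₀
    have : P.groupDim dim (⊤ : AddSubgroup 𝔤) + P.groupDim dim C ≤
      P.groupDim dim (C ⊓ lieTransporter D) + P.groupDim dim (⊤ : AddSubgroup 𝔤) := by
      exact_mod_cast this
    omega
  -- Impossible: `Z₁` has dimension at most `dim C + dim 𝔤 - 1`.
  · have := e.trans (e₁.trans (add_le_add_left e₂ _))
    have : P.groupDim dim (⊤ : AddSubgroup 𝔤) + P.groupDim dim C ≤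
      P.groupDim dim C + (P.groupDim dim (⊤ : AddSubgroup 𝔤) - 1) := by
      exact_mod_cast this
    omega

/-- The definable subgroups of a Lie ring definable in a structure with a dimension. -/
noncomputable def definableDimension (P : L.LieRingPresentation M 𝔤) : DefinableDimension 𝔤 where
  Def := P.IsDefinable
  dim := P.groupDim dim
  def_bot := isDefinable_bot
  def_top := isDefinable_univ
  def_inf _ _ := isDefinable_inf
  def_sup _ _ := isDefinable_sup
  def_map x _ := isDefinable_map x
  def_comap x _ := isDefinable_comap x
  def_transporter _ := isDefinable_lieTransporter
  dim_mono _ _ := groupDim_mono hdim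
  dim_le_iff _ _ := groupDim_le_iff hdim
  almostLE_transporter hconn _ _ := almostLE_lieTransporter hdim hconn

end FirstOrder.Language.LieRingPresentation

/-! ### Conclusion: restriction of the dimension to the given model -/

theorem FirstOrder.Language.Theory.IsDimension.isDimensionOn {L : FirstOrder.Language.{u, v}}
    {T : L.Theory} {dim : ∀ (M : T.ModelType) (n : ℕ) (S : L.ImaginarySort M n),
      Set S.Elem → WithBot ℕ} (h : T.IsDimension dim) (M : T.ModelType) :
    L.IsDimensionOn M (dim M) where
  dim_eq_zero_iff := h.dim_eq_zero_iff M
  dim_union := h.dim_union M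
  le_dim_of_le_dim_fiber := h.le_dim_of_le_dim_fiber M
  dim_le_of_dim_fiber_le := h.dim_le_of_dim_fiber_le M

theorem mainTheorem1 {L : FirstOrder.Language.{u, v}} (T : L.Theory)
    (hT : FirstOrder.Language.Theory.FiniteDimensional.{u, v, w} T)
    (M : Type (max u v w)) [L.Structure M] [Nonempty M] [M ⊨ T]
    (𝔤 : Type x) [LieRing 𝔤] (P : L.LieRingPresentation M 𝔤)
    (hconn : IsDefinablyConnected P.IsDefinable (⊤ : AddSubgroup 𝔤)) :
    ∃ (n : ℕ) (h : Fin (n + 1) → LieIdeal ℤ 𝔤),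
      h 0 = ⊤ ∧ h (Fin.last n) = ⊥ ∧
      (∀ i, P.IsDefinable (h i : Set 𝔤)) ∧
      ∀ i : Fin n,
        h i.succ ≤ h i.castSucc ∧
        ((∀ y ∈ idealFactor (h i.castSucc) (h i.succ),
            y ∈ LieAlgebra.center ℤ (𝔤 ⧸ h i.succ)) ∨
          (IsDefinablyConnected (P.IsDefinableQuot (h i.succ))
              (idealFactor (h i.castSucc) (h i.succ)) ∧
            IsDefinablyMinimalFor 𝔤 (P.IsDefinableQuot (h i.succ))
              (idealFactor (h i.castSucc) (h i.succ)) ∧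
            HasDefinableDCC (P.IsDefinableQuot (h i.succ))
              (idealFactor (h i.castSucc) (h i.succ)))) := by
  obtain ⟨dim, hdim⟩ := hT
  exact DefinableDimension.exists_series
    (S := FirstOrder.Language.LieRingPresentation.definableDimension
      (hdim.isDimensionOn (FirstOrder.Language.Theory.ModelType.of T M)) P) hconn
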